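/- Let $N\ge 1$ and $d$ be integers. For $s\ge 0$ put $\alpha(s)=\pi^{s/2}/\Gamma(\tfrac s2+1)$, let $\mathcal H^{s}$ be the $s$-dimensional Hausdorff measure, normalized in the usual way (built from the sums $\sum_i\alpha(s)(\operatorname{diam}A_i/2)^s$), and put $$\gamma(N):=\frac{\alpha(N)^2}{5^{N-1}\,2^{2N+1}\,\alpha(N-1)}.$$ Let $\Omega\subset\mathbb R^N$ be open. For measurable $u:\Omega\to\mathbb R^d$, $q>0$ and $\varepsilon>0$ put $$B_{u,q}^{\varepsilon}(\Omega):=\int_\Omega\Big(\int_{\Omega\cap B_\varepsilon(x)}\frac1{\varepsilon^N}\frac{|u(x)-u(y)|^q}{|x-y|}\,dy\Big)dx\in[0,\infty],\qquad \underline B_{u,q}(\Omega):=\liminf_{\varepsilon\to0^+}B_{u,q}^{\varepsilon}(\Omega);$$ the latter is the lower infinitesimal Besov $q$-constant of $u$. For $1\le q<\infty$ let $BV^q(\Omega,\mathbb R^d)$ be the set of all $u\in L^q(\Omega,\mathbb R^d)$ with $\sup_{0<\varepsilon<1}B_{u,q}^{\varepsilon}(\Omega)<\infty$. For $u\in L^1_{loc}(\Omega,\mathbb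 R^d)$, let $\mathcal J'_u$ be the set of generalized approximate jump points of $u$, i.e. of all $x\in\Omega$ for which there are $h\in\mathbb R^d\setminus\{0\}$ and $\nu\in S^{N-1}$ with $$\lim_{\rho\to0^+}\ \inf_{c\in\mathbb R^d}\Big\{\frac{1}{\mathcal L^N(B^+_\rho(x,\nu))}\int_{B^+_\rho(x,\nu)}|u(y)-h-c|\,dy+\frac{1}{\mathcal L^N(B^-_\rho(x,\nu))}\int_{B^-_\rho(x,\nu)}|u(y)-c|\,dy\Big\}=0,$$ where $B^\pm_\rho(x,\nu)=\{y\in B_\rho(x):\pm(y-x)\cdot\nu>0\}$. The pair $(h,\nu)$ is unique up to a common change of sign; write $u^{j'}(x):=h$, so that $|u^{j'}(x)|$ is well defined. Then the following hold. 1. For every $u\in L^1_{loc}(\Omega,\mathbb R^d)$ the set $\mathcal J'_u$ and the function $|u^{j'}|$ on it are Borel, and for every $q>0$ $$\underline B_{u,q}(\Omega)\ \ge\ \gamma(N)\int_{\mathcal J'_u}|u^{j'}(x)|^q\,d\mathcal H^{N-1}(x)$$ (both sides may be infinite). 2. The constant $\gamma(N)$ is not optimal: there is a constant $c>\gamma(N)$,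 depending on $N$ only, such that the inequality in 1 holds with $c$ in place of $\gamma(N)$ for all $d$, all open $\Omega\subset\mathbb R^N$, all $u\in L^1_{loc}(\Omega,\mathbb R^d)$ and all $q>0$. 3. In particular, if $1\le q<\infty$ and $u\in BV^q(\Omega,\mathbb R^d)$, then $|u^{j'}|\in L^q(\mathcal J'_u,\mathcal H^{N-1})$. -/

import Mathlib

open MeasureTheory Filter Topology
open scoped ENNReal

noncomputable section

namespace BesovJump

/-- The Euclidean space `ℝⁿ` with its Euclidean norm. -/
abbrev E (n : ℕ) : Type := EuclideanSpace ℝ (Fin n)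

/-- `α(s) = π^(s/2) / Γ(s/2 + 1)`, the volume of the unit ball of `ℝˢ` for integral `s`. -/
def alpha (s : ℝ) : ℝ := Real.pi ^ (s / 2) / Real.Gamma (s / 2 + 1)

/-- The constant `γ(N) = α(N)² / (5^(N-1) 2^(2N+1) α(N-1))`. -/
def gammaConst (N : ℕ) : ℝ :=
  alpha N ^ 2 / ((5 : ℝ) ^ (N - 1) * (2 : ℝ) ^ (2 * N + 1) * alpha ((N : ℝ) - 1))

/-- The normalized `s`-dimensional Hausdorff measure, built from `∑ α(s) (diam Aᵢ / 2)^s`;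
Mathlib's `μH[s]` is built from `∑ (diam Aᵢ)^s`. -/
def hausdorff (N : ℕ) (s : ℝ) : Measure (E N) :=
  ENNReal.ofReal (alpha s / (2 : ℝ) ^ s) • Measure.hausdorffMeasure s

/-- `B⁺_ρ(x, ν)`; the opposite half ball `B⁻_ρ(x, ν)` is `halfBall x ρ (-ν)`. -/
def halfBall {N : ℕ} (x : E N) (ρ : ℝ) (ν : E N) : Set (E N) :=
  {y | y ∈ Metric.ball x ρ ∧ 0 < inner ℝ (y - x) ν}

/-- `(h, ν)` is a generalized approximate jump of `u` at `x`: `h ≠ 0`, `|ν| = 1` and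
`inf_c {⨍_{B⁺_ρ(x,ν)} |u - h - c| + ⨍_{B⁻_ρ(x,ν)} |u - c|} → 0` as `ρ → 0⁺`. -/
def IsGenJump {N d : ℕ} (u : E N → E d) (x : E N) (h : E d) (ν : E N) : Prop :=
  h ≠ 0 ∧ ‖ν‖ = 1 ∧
    Tendsto
      (fun ρ : ℝ => ⨅ c : E d,
        ((⨍⁻ y in halfBall x ρ ν, ‖u y - h - c‖ₑ ∂volume) +
          ⨍⁻ y in halfBall x ρ (-ν), ‖u y - c‖ₑ ∂volume))
      (𝓝[>] 0) (𝓝 0)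

/-- The set `J'_u` of generalized approximate jump points of `u` in `Ω`. -/
def genJumpSet {N d : ℕ} (Ω : Set (E N)) (u : E N → E d) : Set (E N) :=
  {x | x ∈ Ω ∧ ∃ (h : E d) (ν : E N), IsGenJump u x h ν}

open scoped Classical in
/-- The generalized jump `u^{j'}(x)` at `x ∈ J'_u`, extended by `0`. The pair `(h, ν)` is unique
up to a common sign, so that the norm of `u^{j'}(x)` does not depend on the choice made here. -/
def genJump {N d : ℕ} (Ω : Set (E N)) (u : E N → E d) (x : E N) : E d :=
  if hx : x ∈ genJumpSet Ω u then hx.2.choose else 0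

/-- `∫_Ω (∫_{Ω ∩ B_ε(x)} ε^{-N} |u(x) - u(y)|^q / |x - y| dy) dx`, with values in `[0, ∞]`. -/
def besovEnergy {N d : ℕ} (Ω : Set (E N)) (q : ℝ) (u : E N → E d) (ε : ℝ) : ℝ≥0∞ :=
  ∫⁻ x in Ω, ∫⁻ y in Ω ∩ Metric.ball x ε,
    ENNReal.ofReal (1 / ε ^ N * (‖u x - u y‖ ^ q / ‖x - y‖)) ∂volume ∂volume

/-- The Besov `q`-constant. -/
def besovConst {N d : ℕ} (Ω : Set (E N)) (q : ℝ) (u : E N → E d) : ℝ≥0∞ :=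
  ⨆ ε ∈ Set.Ioo (0 : ℝ) 1, besovEnergy Ω q u ε

/-- The lower infinitesimal Besov `q`-constant. -/
def lowerBesovConst {N d : ℕ} (Ω : Set (E N)) (q : ℝ) (u : E N → E d) : ℝ≥0∞ :=
  liminf (fun ε : ℝ => besovEnergy Ω q u ε) (𝓝[>] 0)

/-- `u ∈ BV^q(Ω, ℝᵈ)`: `u ∈ L^q(Ω, ℝᵈ)` and the Besov `q`-constant of `u` is finite. -/
def MemBVq {N d : ℕ} (Ω : Set (E N)) (q : ℝ) (u : E N → E d) : Prop :=
  MemLp u (ENNReal.ofReal q) (volume.restrict Ω) ∧ besovConst Ω q u < ∞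

/-- `∫_{J'_u} |u^{j'}(x)|^q dH^{N-1}(x)`, with values in `[0, ∞]`. -/
def jumpVariation {N d : ℕ} (Ω : Set (E N)) (q : ℝ) (u : E N → E d) : ℝ≥0∞ :=
  ∫⁻ x in genJumpSet Ω u, ENNReal.ofReal (‖genJump Ω u x‖ ^ q) ∂(hausdorff N ((N : ℝ) - 1))

end BesovJump

end

namespace BesovJump

/-! Near a jump point `x`, `u` is close in mean on `B_ρ(x)`, up to an additive constant, to the
function equal to `h` on one side of a hyperplane through `x` and to `0` on the other. So the ball
contains two disjoint sets, each filling almost half of it, across which `u` varies by almost `|h|`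
(`exists_separated_sets`). Two points of `B_ρ(x)` are less than `2ρ` apart, so these pairs
contribute asymptotically at least `α(N)² ρ^(N-1) |h|^q / 2^(N+2)` to the energy with `ε = 2ρ`. On
the concentric ball of radius `ρ/2` the kernel bound doubles, which adds a fraction `4^(-N)` of this
amount (`le_lintegral_besovKernel`).

For a fixed `ρ`, a greedy choice yields disjoint balls of radius `ρ` whose energies add up
(`tsum_le_besovEnergy`). The closed balls of radius `2ρ` with the same centres cover every point
that is good at scale `ρ`, and each point is covered by a ball whose centre has a jump power at
least `1/τ` times its own (`exists_greedy_disjoint_balls`). Every jump point is good at all small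
scales, and the layer cake formula with Fatou's lemma turns these covers into a bound for the
integral against Hausdorff measure (`setLIntegral_hausdorffMeasure_le_liminf`).

Comparing `α(N-1) (2ρ)^(N-1)` with the energy of one ball gives `α(N)² (1 + 4^(-N)) / (2^(2N+1)
α(N-1))`, up to factors close to `1`. Equal radii allow the enlargement factor `2`, so no `5^(N-1)`
is lost. For `N = 1` that power is `1`, and the strict gain over `gammaConst` comes only from the
second scale.

The Borel claims rest on the symmetric means of `|u(x+z) - u(x-z)|`, which converge to `|h|` and do
not involve `h`, `ν` or `c`. -/

variable {N d : ℕ}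

/-! ### Jump functions, half balls and mean oscillation. -/

/-- The jump function across the hyperplane orthogonal to `ν`: it is `h` on the open half space
in the direction `ν` and `0` elsewhere. -/
noncomputable def halfModel (h : E d) (ν : E N) (z : E N) : E d :=
  {z : E N | 0 < inner ℝ z ν}.indicator (fun _ => h) z

lemma isOpen_halfSpace (ν : E N) : IsOpen {z : E N | 0 < inner ℝ z ν} :=
  isOpen_lt continuous_const (by fun_prop)

lemma halfModel_of_pos {h : E d} {ν z : E N} (hz : 0 < inner ℝ z ν) : halfModel h ν z = h :=
  Set.indicator_of_mem (by exact hz) _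

lemma halfModel_of_nonpos {h : E d} {ν z : E N} (hz : inner ℝ z ν ≤ 0) : halfModel h ν z = 0 :=
  Set.indicator_of_notMem (by simpa using hz) _

lemma measurable_halfModel (h : E d) (ν : E N) : Measurable (halfModel h ν) :=
  measurable_const.indicator (isOpen_halfSpace ν).measurableSet

lemma norm_halfModel_le (h : E d) (ν z : E N) : ‖halfModel h ν z‖ ≤ ‖h‖ :=
  norm_indicator_le_norm_self _ _

lemma halfModel_smul (h : E d) (ν : E N) {r : ℝ} (hr : 0 < r) (z : E N) :
    halfModel h ν (r • z) = halfModel h ν z := by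
  rcases lt_or_ge 0 (inner ℝ z ν) with hz | hz
  · rw [halfModel_of_pos hz, halfModel_of_pos (by rw [real_inner_smul_left]; positivity)]
  · rw [halfModel_of_nonpos hz, halfModel_of_nonpos
      (by rw [real_inner_smul_left]; exact mul_nonpos_of_nonneg_of_nonpos hr.le hz)]

/-- The hyperplane orthogonal to a nonzero vector is a null set. -/
lemma volume_hyperplane {ν : E N} (hν : ν ≠ 0) : volume {z : E N | inner ℝ z ν = 0} = 0 := by
  have h := Measure.addHaar_submodule (volume : Measure (E N)) (ℝ ∙ ν)ᗮ (by
    intro h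
    have : ν ∈ (ℝ ∙ ν)ᗮ := h ▸ Submodule.mem_top
    rw [Submodule.mem_orthogonal_singleton_iff_inner_left] at this
    exact hν (inner_self_eq_zero.1 this))
  convert h using 2
  ext z
  simp [Submodule.mem_orthogonal_singleton_iff_inner_left]

lemma ae_inner_ne_zero {ν : E N} (hν : ν ≠ 0) : ∀ᵐ z : E N, inner ℝ z ν ≠ 0 := by
  rw [ae_iff]; simpa using volume_hyperplane hν

lemma ae_inner_sub_ne_zero {ν : E N} (hν : ν ≠ 0) (x : E N) :
    ∀ᵐ y : E N, inner ℝ (y - x) ν ≠ 0 :=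
  (measurePreserving_sub_right volume x).quasiMeasurePreserving.ae (ae_inner_ne_zero hν)

lemma measurableSet_halfBall (x : E N) (ρ : ℝ) (ν : E N) : MeasurableSet (halfBall x ρ ν) :=
  measurableSet_ball.inter ((isOpen_halfSpace ν).measurableSet.preimage (measurable_sub_const x))

lemma disjoint_halfBall_neg (x : E N) (ρ : ℝ) (ν : E N) :
    Disjoint (halfBall x ρ ν) (halfBall x ρ (-ν)) := by
  rw [Set.disjoint_left]
  rintro y ⟨-, h1⟩ ⟨-, h2⟩
  rw [inner_neg_right] at h2
  linarith

lemma ball_ae_eq_halfBall_union {ν : E N} (hν : ν ≠ 0) (x : E N) (ρ : ℝ) :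
    (Metric.ball x ρ : Set (E N)) =ᵐ[volume] (halfBall x ρ ν ∪ halfBall x ρ (-ν) : Set (E N)) := by
  filter_upwards [ae_inner_sub_ne_zero hν x] with y hy
  refine propext ⟨fun h => ?_, ?_⟩
  · rcases lt_or_gt_of_ne hy with h' | h'
    · exact Or.inr ⟨h, by rw [inner_neg_right]; linarith⟩
    · exact Or.inl ⟨h, h'⟩
  · rintro (h | h) <;> exact h.1

lemma volume_halfBall_neg (x : E N) (ρ : ℝ) (ν : E N) :
    volume (halfBall x ρ (-ν)) = volume (halfBall x ρ ν) := by
  have h := (Measure.measurePreserving_sub_left (volume : Measure (E N)) ((2 : ℝ) • x)).measure_preimage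
    (measurableSet_halfBall x ρ ν).nullMeasurableSet
  rw [← h]
  congr 1
  ext y
  have e : (2 : ℝ) • x - y - x = -(y - x) := by rw [two_smul]; abel
  simp only [halfBall, Set.mem_ofPred_eq, Set.mem_preimage, Metric.mem_ball, dist_eq_norm, e,
    norm_neg, inner_neg_left, inner_neg_right]

lemma two_mul_volume_halfBall {ν : E N} (hν : ν ≠ 0) (x : E N) (ρ : ℝ) :
    2 * volume (halfBall x ρ ν) = volume (Metric.ball x ρ) := by
  rw [measure_congr (ball_ae_eq_halfBall_union hν x ρ),
    measure_union (disjoint_halfBall_neg x ρ ν) (measurableSet_halfBall _ _ _),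
    volume_halfBall_neg, two_mul]

/-- The mean oscillation on `ball x ρ` of the difference between `u` and the jump function with
jump `h` across the hyperplane through `x` orthogonal to `ν`. -/
noncomputable def jumpOsc (u : E N → E d) (x : E N) (ρ : ℝ) (h : E d) (ν : E N) : ℝ≥0∞ :=
  ⨅ c : E d, ⨍⁻ y in Metric.ball x ρ, ‖u y - halfModel h ν (y - x) - c‖ₑ ∂volume

/-- Each half ball has half the volume of the ball and the hyperplane is null, so the two half-ball
means become one mean over the full ball, with factor `2`. -/
lemma laverage_halfBall_add (u : E N → E d) (x : E N) (ρ : ℝ) (h c : E d) {ν : E N} (hν : ν ≠ 0) :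
    (⨍⁻ y in halfBall x ρ ν, ‖u y - h - c‖ₑ ∂volume) + ⨍⁻ y in halfBall x ρ (-ν), ‖u y - c‖ₑ ∂volume =
      2 * ⨍⁻ y in Metric.ball x ρ, ‖u y - halfModel h ν (y - x) - c‖ₑ ∂volume := by
  have h1 : ∫⁻ y in halfBall x ρ ν, ‖u y - h - c‖ₑ =
      ∫⁻ y in halfBall x ρ ν, ‖u y - halfModel h ν (y - x) - c‖ₑ :=
    setLIntegral_congr_fun (measurableSet_halfBall _ _ _) fun y hy => by
      simp only [halfModel_of_pos hy.2]
  have h2 : ∫⁻ y in halfBall x ρ (-ν), ‖u y - c‖ₑ =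
      ∫⁻ y in halfBall x ρ (-ν), ‖u y - halfModel h ν (y - x) - c‖ₑ :=
    setLIntegral_congr_fun (measurableSet_halfBall _ _ _) fun y hy => by
      have := hy.2
      rw [inner_neg_right] at this
      simp only [halfModel_of_nonpos (h := h) (by linarith : inner ℝ (y - x) ν ≤ 0), sub_zero]
  rw [setLAverage_eq, setLAverage_eq, setLAverage_eq, h1, h2, volume_halfBall_neg,
    setLIntegral_congr (ball_ae_eq_halfBall_union hν x ρ),
    lintegral_union (measurableSet_halfBall _ _ _) (disjoint_halfBall_neg x ρ ν),
    ← two_mul_volume_halfBall hν, ENNReal.div_add_div_same, div_eq_mul_inv, div_eq_mul_inv,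
    ENNReal.mul_inv (Or.inl two_ne_zero) (Or.inl (by norm_num)), mul_left_comm, ← mul_assoc 2,
    ENNReal.mul_inv_cancel two_ne_zero (by norm_num), one_mul]

lemma isGenJump_iff {u : E N → E d} {x : E N} {h : E d} {ν : E N} :
    IsGenJump u x h ν ↔
      h ≠ 0 ∧ ‖ν‖ = 1 ∧ Tendsto (fun ρ => jumpOsc u x ρ h ν) (𝓝[>] 0) (𝓝 0) := by
  refine and_congr_right fun _ => and_congr_right fun hν => ?_
  have hν0 : ν ≠ 0 := by rintro rfl; simp at hν
  have e : (fun ρ : ℝ => ⨅ c : E d, ((⨍⁻ y in halfBall x ρ ν, ‖u y - h - c‖ₑ ∂volume) +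
      ⨍⁻ y in halfBall x ρ (-ν), ‖u y - c‖ₑ ∂volume)) = fun ρ => 2 * jumpOsc u x ρ h ν := by
    funext ρ
    simp only [laverage_halfBall_add u x ρ h _ hν0, jumpOsc]
    rw [ENNReal.mul_iInf_of_ne two_ne_zero (by norm_num)]
  rw [e]
  constructor <;> intro H
  · have := ENNReal.Tendsto.const_mul (a := 2⁻¹) H (Or.inr (by norm_num))
    simpa [← mul_assoc, ENNReal.inv_mul_cancel] using this
  · simpa using ENNReal.Tendsto.const_mul (a := 2) H (Or.inr (by norm_num))

/-! ### Scale-invariant distance between jump functions. -/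

/-- The mean on `ball 0 ρ` of a function of the direction does not depend on the radius. -/
lemma setLAverage_ball_eq_of_smul {F : E N → ℝ≥0∞} (hF : Measurable F)
    (hs : ∀ r : ℝ, 0 < r → ∀ z, F (r • z) = F z) {ρ : ℝ} (hρ : 0 < ρ) :
    ⨍⁻ z in Metric.ball 0 ρ, F z ∂volume = ⨍⁻ z in Metric.ball 0 1, F z ∂volume := by
  set κ : ℝ≥0∞ := ENNReal.ofReal |((ρ : ℝ) ^ Module.finrank ℝ (E N))⁻¹| with hκ
  have hκ0 : κ ≠ 0 := by
    rw [hκ, Ne, ENNReal.ofReal_eq_zero, not_le]; positivity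
  have hm := Measure.map_addHaar_smul (volume : Measure (E N)) hρ.ne'
  have hpre : (fun z : E N => ρ • z) ⁻¹' Metric.ball 0 ρ = Metric.ball 0 1 := by
    ext z
    simp [norm_smul, abs_of_pos hρ, hρ]
  have hms : Measurable fun z : E N => ρ • z := measurable_const_smul ρ
  have h1 : κ * ∫⁻ z in Metric.ball 0 ρ, F z = ∫⁻ z in Metric.ball 0 1, F z := by
    have : ∫⁻ z in Metric.ball 0 ρ, F z ∂(Measure.map (fun z : E N => ρ • z) volume) =
        ∫⁻ z in Metric.ball 0 1, F z := by
      rw [Measure.restrict_map hms measurableSet_ball, lintegral_map hF hms, hpre]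
      simp only [hs ρ hρ]
    rw [← this, hm, Measure.restrict_smul, lintegral_smul_measure, smul_eq_mul]
  have h2 : κ * volume (Metric.ball (0 : E N) ρ) = volume (Metric.ball (0 : E N) 1) := by
    rw [← hpre, ← Measure.map_apply hms measurableSet_ball, hm, Measure.smul_apply, smul_eq_mul]
  rw [setLAverage_eq, setLAverage_eq, ← h1, ← h2,
    ENNReal.mul_div_mul_left _ _ hκ0 ENNReal.ofReal_ne_top]

/-- Translating a mean to the origin. -/
lemma setLAverage_ball_comp_sub {F : E N → ℝ≥0∞} (hF : Measurable F) (x : E N) (ρ : ℝ) :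
    ⨍⁻ y in Metric.ball x ρ, F (y - x) ∂volume = ⨍⁻ z in Metric.ball 0 ρ, F z ∂volume := by
  have hp := measurePreserving_sub_right (volume : Measure (E N)) x
  have hpre : (fun y : E N => y - x) ⁻¹' Metric.ball 0 ρ = Metric.ball x ρ := by
    ext y; simp [dist_eq_norm]
  rw [setLAverage_eq, setLAverage_eq, ← hpre, hp.measure_preimage
    measurableSet_ball.nullMeasurableSet, hp.setLIntegral_comp_preimage measurableSet_ball hF]

/-- The distance between two jump functions. -/
noncomputable def modelDist (h : E d) (ν : E N) (h' : E d) (ν' : E N) : ℝ≥0∞ :=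
  ⨍⁻ z in Metric.ball 0 1, ‖halfModel h' ν' z - halfModel h ν z‖ₑ ∂volume

/-- Jump functions are homogeneous of degree `0`, so the mean of their difference over `ball x ρ`
does not depend on `x` or `ρ`. The error of changing `(h, ν)` is therefore uniform in the scale. -/
lemma jumpOsc_le_add_modelDist (u : E N → E d) (x : E N) {ρ : ℝ} (hρ : 0 < ρ)
    (h : E d) (ν : E N) (h' : E d) (ν' : E N) :
    jumpOsc u x ρ h ν ≤ jumpOsc u x ρ h' ν' + modelDist h ν h' ν' := by
  have hF : Measurable fun z : E N => ‖halfModel h' ν' z - halfModel h ν z‖ₑ :=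
    ((measurable_halfModel h' ν').sub (measurable_halfModel h ν)).enorm
  have hD : modelDist h ν h' ν' =
      ⨍⁻ y in Metric.ball x ρ, ‖halfModel h' ν' (y - x) - halfModel h ν (y - x)‖ₑ ∂volume := by
    rw [setLAverage_ball_comp_sub hF x ρ, setLAverage_ball_eq_of_smul hF ?_ hρ, modelDist]
    intro r hr z
    simp only [halfModel_smul _ _ hr]
  rw [jumpOsc, jumpOsc, ENNReal.iInf_add]
  refine le_iInf fun c => (iInf_le _ c).trans ?_
  rw [hD, setLAverage_eq, setLAverage_eq, setLAverage_eq, ENNReal.div_add_div_same,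
    ← lintegral_add_right _ (by exact hF.comp (measurable_id.sub_const x))]
  refine ENNReal.div_le_div_right (lintegral_mono fun y => ?_) _
  refine le_trans (le_of_eq ?_) (enorm_add_le _ _)
  congr 1; abel

/-- Dominated convergence: off the hyperplane of `ν`, a point stays on its side for all directions
near `ν`. -/
lemma tendsto_modelDist (h : E d) {ν : E N} (hν : ν ≠ 0) :
    Tendsto (fun p : E d × E N => modelDist h ν p.1 p.2) (𝓝 (h, ν)) (𝓝 0) := by
  have key : Tendsto (fun p : E d × E N =>
      ∫⁻ z in Metric.ball 0 1, ‖halfModel p.1 p.2 z - halfModel h ν z‖ₑ) (𝓝 (h, ν)) (𝓝 0) := by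
    have h0 : (0 : ℝ≥0∞) = ∫⁻ z in Metric.ball (0 : E N) 1, 0 := by simp
    rw [h0]
    refine tendsto_lintegral_filter_of_dominated_convergence
      (fun _ => ENNReal.ofReal (‖h‖ + 1 + ‖h‖))
      (.of_forall fun p => ((measurable_halfModel _ _).sub (measurable_halfModel _ _)).enorm)
      ?_ ?_ (ae_restrict_of_ae ?_)
    · have : ∀ᶠ p : E d × E N in 𝓝 (h, ν), ‖p.1‖ < ‖h‖ + 1 :=
        (continuous_fst.norm.tendsto (h, ν)).eventually_lt_const (by simp)
      filter_upwards [this] with p hp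
      refine .of_forall fun z => ?_
      rw [← ofReal_norm]
      refine ENNReal.ofReal_le_ofReal ((norm_sub_le _ _).trans ?_)
      have := norm_halfModel_le p.1 p.2 z
      have := norm_halfModel_le h ν z
      linarith
    · rw [lintegral_const]
      exact ENNReal.mul_ne_top ENNReal.ofReal_ne_top
        (by rw [Measure.restrict_apply_univ]; exact measure_ball_lt_top.ne)
    · filter_upwards [ae_inner_ne_zero hν] with z hz
      have hc : Tendsto (fun p : E d × E N => inner ℝ z p.2) (𝓝 (h, ν)) (𝓝 (inner ℝ z ν)) :=
        by
        have : Continuous fun p : E d × E N => (inner ℝ z p.2 : ℝ) := by fun_prop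
        exact this.tendsto (h, ν)
      rcases lt_or_gt_of_ne hz with hz | hz
      · refine tendsto_const_nhds.congr' ?_
        filter_upwards [hc.eventually_lt_const hz] with p hp
        simp [halfModel_of_nonpos hz.le, halfModel_of_nonpos hp.le]
      · have h1 : Tendsto (fun p : E d × E N => ‖p.1 - h‖ₑ) (𝓝 (h, ν)) (𝓝 0) := by
          have : Continuous fun p : E d × E N => ‖p.1 - h‖ₑ := by fun_prop
          simpa using this.tendsto (h, ν)
        refine h1.congr' ?_
        filter_upwards [hc.eventually_const_lt hz] with p hp
        rw [halfModel_of_pos hz, halfModel_of_pos hp]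
  simp only [modelDist, setLAverage_eq]
  have hv : volume (Metric.ball (0 : E N) 1) ≠ 0 :=
    (Metric.measure_ball_pos volume (0 : E N) one_pos).ne'
  simpa using ENNReal.Tendsto.div_const key (Or.inr hv)

/-! ### Measurability of the oscillation in the base point. -/

lemma setLAverage_const_add_le {F : E N → ℝ≥0∞} (a : ℝ≥0∞) (s : Set (E N)) :
    ⨍⁻ y in s, (F y + a) ∂volume ≤ ⨍⁻ y in s, F y ∂volume + a := by
  rw [setLAverage_eq, setLAverage_eq, lintegral_add_right _ measurable_const, lintegral_const,
    Measure.restrict_apply_univ, ENNReal.add_div]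
  gcongr
  rw [mul_div_assoc]
  exact mul_le_of_le_one_right (zero_le) ENNReal.div_self_le_one

lemma setLAverage_mono {F G : E N → ℝ≥0∞} {s : Set (E N)} (h : ∀ᵐ y, F y ≤ G y) :
    ⨍⁻ y in s, F y ∂volume ≤ ⨍⁻ y in s, G y ∂volume := by
  rw [setLAverage_eq, setLAverage_eq]
  exact ENNReal.div_le_div_right (lintegral_mono_ae (ae_restrict_of_ae h)) _

lemma measurable_sub_halfModel_enorm {u : E N → E d} (hu : Measurable u) (h : E d) (ν : E N)
    (c : E d) : Measurable fun p : E N × E N => ‖u (p.1 + p.2) - halfModel h ν p.2 - c‖ₑ :=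
  (((hu.comp (measurable_fst.add measurable_snd)).sub
    ((measurable_halfModel h ν).comp measurable_snd)).sub_const c).enorm

lemma measurable_translate_sub_halfModel_enorm {u : E N → E d} (hu : Measurable u) (x : E N)
    (h : E d) (ν : E N) (c : E d) :
    Measurable fun z : E N => ‖u (x + z) - halfModel h ν z - c‖ₑ :=
  (((hu.comp (measurable_const_add x)).sub (measurable_halfModel h ν)).sub_const c).enorm

lemma setLAverage_halfModel_eq {u : E N → E d} (hu : Measurable u) (x : E N) (ρ : ℝ) (h : E d)
    (ν : E N) (c : E d) :
    ⨍⁻ y in Metric.ball x ρ, ‖u y - halfModel h ν (y - x) - c‖ₑ ∂volume =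
      ⨍⁻ z in Metric.ball 0 ρ, ‖u (x + z) - halfModel h ν z - c‖ₑ ∂volume := by
  rw [← setLAverage_ball_comp_sub
    (measurable_translate_sub_halfModel_enorm hu x h ν c) x ρ]
  simp

/-- The mean is 1-Lipschitz in `c`, so countably many `c` suffice; this makes the infimum measurable
in `x`. -/
lemma jumpOsc_eq_iInf_denseSeq (u : E N → E d) (x : E N) (ρ : ℝ) (h : E d) (ν : E N) :
    jumpOsc u x ρ h ν = ⨅ n : ℕ, ⨍⁻ y in Metric.ball x ρ,
      ‖u y - halfModel h ν (y - x) - TopologicalSpace.denseSeq (E d) n‖ₑ ∂volume := by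
  refine le_antisymm (le_iInf fun n => iInf_le _ _) (le_iInf fun c => ?_)
  refine ENNReal.le_of_forall_pos_le_add fun δ hδ _ => ?_
  obtain ⟨n, hn⟩ := (TopologicalSpace.denseRange_denseSeq (E d)).exists_dist_lt c
    (NNReal.coe_pos.2 hδ)
  refine (iInf_le _ n).trans (le_trans (setLAverage_mono (.of_forall fun y => ?_))
    (setLAverage_const_add_le (δ : ℝ≥0∞) _))
  have e : u y - halfModel h ν (y - x) - TopologicalSpace.denseSeq (E d) n =
      (u y - halfModel h ν (y - x) - c) + (c - TopologicalSpace.denseSeq (E d) n) := by abel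
  rw [e]
  refine (enorm_add_le _ _).trans (add_le_add le_rfl ?_)
  rw [← ofReal_norm, ← dist_eq_norm]
  exact (ENNReal.ofReal_le_ofReal hn.le).trans (by simp)

lemma measurable_setLAverage_ball {F : E N × E N → ℝ≥0∞} (hF : Measurable F) (ρ : ℝ) :
    Measurable fun x => ⨍⁻ z in Metric.ball 0 ρ, F (x, z) ∂volume := by
  simp only [setLAverage_eq]
  exact (Measurable.lintegral_prod_right' hF).div_const _

lemma measurable_jumpOsc {u : E N → E d} (hu : Measurable u) (ρ : ℝ) (h : E d) (ν : E N) :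
    Measurable fun x => jumpOsc u x ρ h ν := by
  simp only [jumpOsc_eq_iInf_denseSeq, setLAverage_halfModel_eq hu]
  exact .iInf fun n => measurable_setLAverage_ball (measurable_sub_halfModel_enorm hu h ν _) ρ

/-! ### Symmetric means, which recover the size of the jump. -/

/-- The mean of `|u(x + z) - u(x - z)|` for `z` in the ball of radius `ρ`. -/
noncomputable def symMean (u : E N → E d) (x : E N) (ρ : ℝ) : ℝ≥0∞ :=
  ⨍⁻ z in Metric.ball (0 : E N) ρ, ‖u (x + z) - u (x - z)‖ₑ ∂volume

lemma measurable_symMean {u : E N → E d} (hu : Measurable u) (ρ : ℝ) :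
    Measurable fun x => symMean u x ρ :=
  measurable_setLAverage_ball (F := fun p => ‖u (p.1 + p.2) - u (p.1 - p.2)‖ₑ)
    ((hu.comp (measurable_fst.add measurable_snd)).sub
      (hu.comp (measurable_fst.sub measurable_snd))).enorm ρ

lemma setLAverage_ball_comp_neg {F : E N → ℝ≥0∞} (hF : Measurable F) (ρ : ℝ) :
    ⨍⁻ z in Metric.ball 0 ρ, F (-z) ∂volume = ⨍⁻ z in Metric.ball 0 ρ, F z ∂volume := by
  have hp := Measure.measurePreserving_neg (volume : Measure (E N))
  have hpre : (fun y : E N => -y) ⁻¹' Metric.ball 0 ρ = Metric.ball 0 ρ := by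
    ext y; simp
  rw [setLAverage_eq, setLAverage_eq]
  nth_rw 1 [← hpre]
  exact congrArg (· / _) (hp.setLIntegral_comp_preimage measurableSet_ball hF)

lemma halfModel_sub_neg (h : E d) {ν z : E N} (hz : inner ℝ z ν ≠ 0) :
    ‖halfModel h ν z - halfModel h ν (-z)‖ₑ = ‖h‖ₑ := by
  rcases lt_or_gt_of_ne hz with hz | hz
  · rw [halfModel_of_nonpos hz.le, halfModel_of_pos (by rw [inner_neg_left]; linarith), zero_sub,
      enorm_neg]
  · rw [halfModel_of_pos hz, halfModel_of_nonpos (by rw [inner_neg_left]; linarith), sub_zero]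

/-- The reflection `z ↦ -z` exchanges the two sides, so the jump function contributes exactly `|h|`
almost everywhere and `c` cancels. The remaining errors at `z` and `-z` have the same mean, whence
the factor `2`. -/
lemma symMean_bounds {u : E N → E d} (hu : Measurable u) (x : E N) {ρ : ℝ} (hρ : 0 < ρ)
    (h : E d) {ν : E N} (hν : ν ≠ 0) :
    symMean u x ρ ≤ 2 * jumpOsc u x ρ h ν + ‖h‖ₑ ∧
      ‖h‖ₑ ≤ symMean u x ρ + 2 * jumpOsc u x ρ h ν := by
  set B : Set (E N) := Metric.ball 0 ρ
  have key : ∀ c : E d, symMean u x ρ ≤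
        2 * (⨍⁻ y in Metric.ball x ρ, ‖u y - halfModel h ν (y - x) - c‖ₑ ∂volume) + ‖h‖ₑ ∧
      ‖h‖ₑ ≤ symMean u x ρ +
        2 * ⨍⁻ y in Metric.ball x ρ, ‖u y - halfModel h ν (y - x) - c‖ₑ ∂volume := by
    intro c
    set w : E N → E d := fun z => u (x + z) - halfModel h ν z - c with hw
    have hwm : Measurable fun z => ‖w z‖ₑ :=
      measurable_translate_sub_halfModel_enorm hu x h ν c
    have hsm : Measurable fun z => ‖u (x + z) - u (x - z)‖ₑ :=
      ((hu.comp (measurable_const_add x)).sub (hu.comp (measurable_const_sub x))).enorm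
    have h2 : (2 * ⨍⁻ y in Metric.ball x ρ, ‖u y - halfModel h ν (y - x) - c‖ₑ ∂volume) =
        ⨍⁻ z in B, (‖w z‖ₑ + ‖w (-z)‖ₑ) ∂volume := by
      rw [setLAverage_halfModel_eq hu, two_mul,
        setLAverage_eq _ (fun z => ‖w z‖ₑ + ‖w (-z)‖ₑ) B, lintegral_add_left hwm,
        ENNReal.add_div, ← setLAverage_eq, ← setLAverage_eq, setLAverage_ball_comp_neg hwm]
    have hone : ∀ a : ℝ≥0∞, ⨍⁻ _z in B, a ∂volume = a := fun a =>
      setLAverage_const (Metric.measure_ball_pos volume _ hρ).ne' measure_ball_lt_top.ne a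
    have hid : ∀ z : E N, u (x + z) - u (x - z) =
        (w z - w (-z)) + (halfModel h ν z - halfModel h ν (-z)) := by
      intro z; simp only [hw, ← sub_eq_add_neg]; abel
    constructor
    · rw [h2]
      refine le_trans (setLAverage_mono ?_) (setLAverage_const_add_le _ _)
      filter_upwards [ae_inner_ne_zero hν] with z hz
      rw [hid z, ← halfModel_sub_neg h hz]
      exact (enorm_add_le _ _).trans (add_le_add_left (enorm_sub_le ..) _)
    · rw [h2, symMean, setLAverage_eq, setLAverage_eq, ENNReal.div_add_div_same,
        ← lintegral_add_left hsm, ← setLAverage_eq]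
      nth_rw 1 [← hone ‖h‖ₑ]
      refine setLAverage_mono ?_
      filter_upwards [ae_inner_ne_zero hν] with z hz
      rw [← halfModel_sub_neg h hz]
      have : halfModel h ν z - halfModel h ν (-z) =
        (u (x + z) - u (x - z)) - (w z - w (-z)) := by rw [hid z]; abel
      rw [this]
      exact (enorm_sub_le ..).trans (add_le_add_right (enorm_sub_le ..) _)
  constructor
  · rw [jumpOsc, ENNReal.mul_iInf_of_ne two_ne_zero (by norm_num), ENNReal.iInf_add]
    exact le_iInf fun c => (key c).1
  · rw [jumpOsc, ENNReal.mul_iInf_of_ne two_ne_zero (by norm_num), ENNReal.add_iInf]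
    exact le_iInf fun c => (key c).2

lemma tendsto_symMean {u : E N → E d} (hu : Measurable u) {x : E N} {h : E d} {ν : E N}
    (hν : ν ≠ 0) {l : Filter ℝ} (hl : l ≤ 𝓝[>] 0)
    (H : Tendsto (fun ρ => jumpOsc u x ρ h ν) l (𝓝 0)) :
    Tendsto (fun ρ => symMean u x ρ) l (𝓝 ‖h‖ₑ) := by
  have h2 : Tendsto (fun ρ => 2 * jumpOsc u x ρ h ν) l (𝓝 0) := by
    simpa using ENNReal.Tendsto.const_mul (a := 2) H (Or.inr (by norm_num))
  have hup : Tendsto (fun ρ => 2 * jumpOsc u x ρ h ν + ‖h‖ₑ) l (𝓝 ‖h‖ₑ) := by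
    simpa using h2.add_const ‖h‖ₑ
  have hlo : Tendsto (fun ρ => ‖h‖ₑ - 2 * jumpOsc u x ρ h ν) l (𝓝 ‖h‖ₑ) := by
    simpa using ENNReal.Tendsto.sub tendsto_const_nhds h2 (Or.inl enorm_ne_top)
  have hpos : ∀ᶠ ρ in l, 0 < ρ := hl self_mem_nhdsWithin
  refine tendsto_of_tendsto_of_tendsto_of_le_of_le' hlo hup ?_ ?_
  · filter_upwards [hpos] with ρ hρ
    exact tsub_le_iff_right.2 (symMean_bounds hu x hρ h hν).2
  · filter_upwards [hpos] with ρ hρ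
    exact (symMean_bounds hu x hρ h hν).1

/-! ### Reduction to dyadic radii and Borel measurability of the jump set. -/

/-- Doubling the radius multiplies the volume by `2 ^ N`; hence dyadic radii control all radii. -/
lemma jumpOsc_le_two_pow_mul (u : E N → E d) (x : E N) {ρ r : ℝ} (hρ : 0 < ρ) (h1 : ρ ≤ r)
    (h2 : r ≤ 2 * ρ) (h : E d) (ν : E N) :
    jumpOsc u x ρ h ν ≤ 2 ^ N * jumpOsc u x r h ν := by
  rw [jumpOsc, jumpOsc, ENNReal.mul_iInf_of_ne (by simp) (by simp)]
  refine le_iInf fun c => (iInf_le _ c).trans ?_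
  rw [setLAverage_eq, setLAverage_eq]
  have hv : volume (Metric.ball x r) ≤ 2 ^ N * volume (Metric.ball x ρ) := by
    rw [Measure.addHaar_ball_of_pos _ _ (hρ.trans_le h1), Measure.addHaar_ball_of_pos _ _ hρ,
      ← mul_assoc]
    gcongr
    rw [finrank_euclideanSpace, Fintype.card_fin]
    calc ENNReal.ofReal (r ^ N) ≤ ENNReal.ofReal ((2 * ρ) ^ N) := by
          gcongr
          exact hρ.le.trans h1
      _ = 2 ^ N * ENNReal.ofReal (ρ ^ N) := by
          rw [mul_pow, ENNReal.ofReal_mul (by positivity)]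
          norm_num [ENNReal.ofReal_pow]
  have hρ0 : volume (Metric.ball x ρ) ≠ 0 := (Metric.measure_ball_pos volume x hρ).ne'
  calc (∫⁻ y in Metric.ball x ρ, ‖u y - halfModel h ν (y - x) - c‖ₑ) / volume (Metric.ball x ρ)
      ≤ (∫⁻ y in Metric.ball x r, ‖u y - halfModel h ν (y - x) - c‖ₑ) /
          volume (Metric.ball x ρ) :=
        ENNReal.div_le_div_right (lintegral_mono_set (Metric.ball_subset_ball h1)) _
    _ = (2 ^ N * ∫⁻ y in Metric.ball x r, ‖u y - halfModel h ν (y - x) - c‖ₑ) /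
          (2 ^ N * volume (Metric.ball x ρ)) :=
        (ENNReal.mul_div_mul_left _ _ (by simp) (by simp)).symm
    _ ≤ (2 ^ N * ∫⁻ y in Metric.ball x r, ‖u y - halfModel h ν (y - x) - c‖ₑ) /
          volume (Metric.ball x r) := ENNReal.div_le_div_left hv _
    _ = _ := by rw [mul_div_assoc]

lemma tendsto_half_pow : Tendsto (fun j : ℕ => (1 / 2 : ℝ) ^ j) atTop (𝓝[>] 0) :=
  tendsto_nhdsWithin_iff.2 ⟨tendsto_pow_atTop_nhds_zero_of_lt_one (by norm_num) (by norm_num),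
    .of_forall fun j => by simp only [Set.mem_Ioi]; positivity⟩

lemma tendsto_jumpOsc_of_half_pow {u : E N → E d} {x : E N} {h : E d} {ν : E N}
    (H : Tendsto (fun j : ℕ => jumpOsc u x ((1 / 2 : ℝ) ^ j) h ν) atTop (𝓝 0)) :
    Tendsto (fun ρ => jumpOsc u x ρ h ν) (𝓝[>] 0) (𝓝 0) := by
  have H2 : Tendsto (fun j : ℕ => 2 ^ N * jumpOsc u x ((1 / 2 : ℝ) ^ j) h ν) atTop (𝓝 0) := by
    simpa using ENNReal.Tendsto.const_mul (a := 2 ^ N) H (Or.inr (by simp))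
  rw [ENNReal.tendsto_nhds_zero] at H2 ⊢
  intro δ hδ
  obtain ⟨J, hJ⟩ := eventually_atTop.1 (H2 δ hδ)
  filter_upwards [Ioo_mem_nhdsGT (by positivity : (0 : ℝ) < (1 / 2) ^ J)] with ρ hρ
  obtain ⟨n, hn1, hn2⟩ := exists_nat_pow_near_of_lt_one hρ.1
    (hρ.2.le.trans (pow_le_one₀ (by norm_num) (by norm_num)))
    (by norm_num : (0 : ℝ) < 1 / 2) (by norm_num)
  have hJn : J < n + 1 :=
    (pow_lt_pow_iff_right_of_lt_one₀ (by norm_num) (by norm_num)).1 (hn1.trans hρ.2)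
  refine (jumpOsc_le_two_pow_mul u x hρ.1 hn2 ?_ h ν).trans (hJ n (by omega))
  rw [pow_succ] at hn1
  linarith

/-- Points at which `u` is asymptotically close, at dyadic scales and up to constants, to jump
functions taken in the family `D`. -/
def nearJumpSet (u : E N → E d) (D : Set (E d × Metric.sphere (0 : E N) 1)) : Set (E N) :=
  {x | ∀ k : ℕ, ∃ p ∈ D, ∀ᶠ j : ℕ in atTop,
    jumpOsc u x ((1 / 2 : ℝ) ^ j) p.1 p.2 < ((k : ℝ≥0∞) + 1)⁻¹}

lemma measurableSet_nearJumpSet {u : E N → E d} (hu : Measurable u)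
    {D : Set (E d × Metric.sphere (0 : E N) 1)} (hD : D.Countable) :
    MeasurableSet (nearJumpSet u D) := by
  have e : nearJumpSet u D = ⋂ k : ℕ, ⋃ p ∈ D, ⋃ J : ℕ, ⋂ j : ℕ, ⋂ _ : J ≤ j,
      {x | jumpOsc u x ((1 / 2 : ℝ) ^ j) p.1 p.2 < ((k : ℝ≥0∞) + 1)⁻¹} := by
    ext x
    simp [nearJumpSet, eventually_atTop]
  rw [e]
  exact .iInter fun k => .biUnion hD fun p _ => .iUnion fun J => .iInter fun j => .iInter fun _ =>
    measurableSet_lt (measurable_jumpOsc hu _ _ _) measurable_const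

lemma mem_nearJumpSet_of_tendsto {u : E N → E d} {x : E N}
    {D : Set (E d × Metric.sphere (0 : E N) 1)} (hD : Dense D) {h : E d} {ν : E N} (hν : ‖ν‖ = 1)
    (H : Tendsto (fun ρ => jumpOsc u x ρ h ν) (𝓝[>] 0) (𝓝 0)) : x ∈ nearJumpSet u D := by
  intro k
  have hν0 : ν ≠ 0 := by rintro rfl; simp at hν
  set δ : ℝ≥0∞ := ((k : ℝ≥0∞) + 1)⁻¹ with hδ
  have hδ0 : 0 < δ / 2 := ENNReal.half_pos (by simp [hδ])
  obtain ⟨P, hPh, hPν⟩ : ∃ P : E d × Metric.sphere (0 : E N) 1, P.1 = h ∧ (P.2 : E N) = ν :=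
    ⟨(h, ⟨ν, by simpa using hν⟩), rfl, rfl⟩
  have hc : Tendsto (fun p : E d × Metric.sphere (0 : E N) 1 => modelDist h ν p.1 p.2)
      (𝓝 P) (𝓝 0) := by
    have hc' : Continuous fun p : E d × Metric.sphere (0 : E N) 1 => (p.1, (p.2 : E N)) := by
      fun_prop
    have hP : Tendsto (fun p : E d × Metric.sphere (0 : E N) 1 => (p.1, (p.2 : E N)))
      (𝓝 P) (𝓝 (h, ν)) := by
      have := hc'.tendsto P
      rwa [hPh, hPν] at this
    have hT := (tendsto_modelDist h hν0).comp hP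
    simpa only [Function.comp_def] using hT
  obtain ⟨p, hp1, hp2⟩ := hD.inter_nhds_nonempty (hc.eventually_lt_const hδ0)
  refine ⟨p, hp1, ?_⟩
  filter_upwards [(H.comp tendsto_half_pow).eventually_lt_const hδ0] with j hj
  have hp3 : modelDist p.1 (p.2 : E N) h ν < δ / 2 := by
    refine lt_of_eq_of_lt ?_ hp2
    simp only [modelDist, enorm_sub_rev]
  calc jumpOsc u x ((1 / 2 : ℝ) ^ j) p.1 p.2
      ≤ jumpOsc u x ((1 / 2 : ℝ) ^ j) h ν + modelDist p.1 (p.2 : E N) h ν :=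
        jumpOsc_le_add_modelDist u x (by positivity) _ _ _ _
    _ < δ / 2 + δ / 2 := ENNReal.add_lt_add hj hp3
    _ = δ := ENNReal.add_halves δ

/-- Compactness: the approximating pairs `(h_k, ν_k)` are bounded, and a limit of a subsequence is
close to them in `modelDist` at every scale simultaneously. The limit `h` may be `0`. -/
lemma exists_tendsto_of_mem_nearJumpSet {u : E N → E d} (hu : Measurable u) {x : E N}
    {D : Set (E d × Metric.sphere (0 : E N) 1)} (hx : x ∈ nearJumpSet u D) :
    ∃ (h : E d) (ν : E N), ‖ν‖ = 1 ∧
      Tendsto (fun ρ => jumpOsc u x ρ h ν) (𝓝[>] 0) (𝓝 0) := by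
  choose p _ hp using hx
  have hν0 : ∀ k, ((p k).2 : E N) ≠ 0 := fun k => ne_zero_of_mem_unit_sphere _
  have hle1 : ∀ k : ℕ, ((k : ℝ≥0∞) + 1)⁻¹ ≤ 1 := fun k =>
    ENNReal.inv_le_one.2 le_add_self
  have hbd : ∀ k, ‖(p k).1‖ ≤ ‖(p 0).1‖ + 4 := by
    intro k
    -- At a common radius where both approximations hold, the same symmetric mean is within `2` of
    -- both `|h_0|` and `|h_k|`, hence the bound with `4`.
    obtain ⟨j, hj0, hjk⟩ := ((hp 0).and (hp k)).exists
    have hr : (0 : ℝ) < (1 / 2) ^ j := by positivity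
    have h1 := (symMean_bounds hu x hr (p k).1 (hν0 k)).2
    have h2 := (symMean_bounds hu x hr (p 0).1 (hν0 0)).1
    have h3 : ‖(p k).1‖ₑ ≤ ‖(p 0).1‖ₑ + 4 := by
      calc ‖(p k).1‖ₑ ≤ (2 * 1 + ‖(p 0).1‖ₑ) + 2 * 1 :=
            h1.trans (add_le_add (h2.trans (add_le_add (mul_le_mul_right
              (hj0.le.trans (hle1 0)) 2) le_rfl)) (mul_le_mul_right (hjk.le.trans (hle1 k)) 2))
        _ = ‖(p 0).1‖ₑ + 4 := by ring_nf
    have h4 := ENNReal.toReal_mono (by simp) h3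
    rwa [ENNReal.toReal_add enorm_ne_top (by simp), toReal_enorm, toReal_enorm,
      ENNReal.toReal_ofNat] at h4
  set q : ℕ → E d × E N := fun k => ((p k).1, ((p k).2 : E N)) with hq
  have hK : IsCompact (Metric.closedBall (0 : E d) (‖(p 0).1‖ + 4) ×ˢ Metric.sphere (0 : E N) 1) :=
    (isCompact_closedBall _ _).prod (isCompact_sphere _ _)
  obtain ⟨⟨h, ν⟩, hmem, φ, hφ, hlim⟩ := hK.tendsto_subseq (x := q)
    (fun k => ⟨by simpa using hbd k, (p k).2.2⟩)
  have hν : ‖ν‖ = 1 := by simpa using hmem.2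
  have hν' : ν ≠ 0 := by rintro rfl; simp at hν
  refine ⟨h, ν, hν, tendsto_jumpOsc_of_half_pow ?_⟩
  rw [ENNReal.tendsto_nhds_zero]
  intro δ hδ
  have hδ2 : 0 < δ / 2 := ENNReal.half_pos hδ.ne'
  have hk : Tendsto (fun k : ℕ => ((k : ℝ≥0∞) + 1)⁻¹) atTop (𝓝 0) := by
    have := (tendsto_add_atTop_iff_nat (f := fun k : ℕ => ((k : ℝ≥0∞))⁻¹) 1).2
      ENNReal.tendsto_inv_nat_nhds_zero
    simpa using this
  obtain ⟨k, hk1, hk2⟩ := ((((tendsto_modelDist h hν').comp hlim).eventually_lt_const hδ2).and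
    ((hk.comp hφ.tendsto_atTop).eventually_lt_const hδ2)).exists
  filter_upwards [hp (φ k)] with j hj
  calc jumpOsc u x ((1 / 2 : ℝ) ^ j) h ν
      ≤ jumpOsc u x ((1 / 2 : ℝ) ^ j) (p (φ k)).1 (p (φ k)).2 +
          modelDist h ν (p (φ k)).1 ((p (φ k)).2 : E N) :=
        jumpOsc_le_add_modelDist u x (by positivity) _ _ _ _
    _ ≤ δ / 2 + δ / 2 := add_le_add (hj.le.trans (le_of_lt hk2)) (le_of_lt hk1)
    _ = δ := ENNReal.add_halves δ

/-- The norm of the jump is the limit of the symmetric means. -/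
lemma IsGenJump.tendsto_symMean {u : E N → E d} (hu : Measurable u) {x : E N} {h : E d} {ν : E N}
    (H : IsGenJump u x h ν) : Tendsto (fun ρ => symMean u x ρ) (𝓝[>] 0) (𝓝 ‖h‖ₑ) := by
  obtain ⟨-, hν, hlim⟩ := isGenJump_iff.1 H
  exact BesovJump.tendsto_symMean hu (by rintro rfl; simp at hν) le_rfl hlim

lemma genJump_spec {Ω : Set (E N)} {u : E N → E d} {x : E N} (hx : x ∈ genJumpSet Ω u) :
    ∃ ν, IsGenJump u x (genJump Ω u x) ν := by
  rw [genJump, dif_pos hx]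
  exact hx.2.choose_spec

lemma genJump_of_notMem {Ω : Set (E N)} {u : E N → E d} {x : E N} (hx : x ∉ genJumpSet Ω u) :
    genJump Ω u x = 0 := by
  rw [genJump, dif_neg hx]

/-- `nearJumpSet` also admits a vanishing jump; positivity of the limiting symmetric mean excludes
exactly this case. -/
lemma genJumpSet_eq {Ω : Set (E N)} {u : E N → E d} (hu : Measurable u)
    {D : Set (E d × Metric.sphere (0 : E N) 1)} (hD : Dense D) :
    genJumpSet Ω u = Ω ∩ (nearJumpSet u D ∩
      {x | 0 < limsup (fun j : ℕ => symMean u x ((1 / 2 : ℝ) ^ j)) atTop}) := by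
  ext x
  refine and_congr_right fun _ => ⟨?_, ?_⟩
  · rintro ⟨h, ν, H⟩
    have hlim := ((H.tendsto_symMean hu).comp tendsto_half_pow).limsup_eq
    obtain ⟨h0, hν, H'⟩ := isGenJump_iff.1 H
    refine ⟨mem_nearJumpSet_of_tendsto hD hν H', ?_⟩
    simp only [Set.mem_ofPred_eq, Function.comp_def] at hlim ⊢
    rw [hlim]
    simpa using h0
  · rintro ⟨hx, hpos⟩
    obtain ⟨h, ν, hν, H⟩ := exists_tendsto_of_mem_nearJumpSet hu hx
    refine ⟨h, ν, isGenJump_iff.2 ⟨?_, hν, H⟩⟩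
    rintro rfl
    have hlim := ((tendsto_symMean hu (by rintro rfl; simp at hν) le_rfl H).comp
      tendsto_half_pow).limsup_eq
    simp only [Set.mem_ofPred_eq, Function.comp_def] at hlim hpos
    rw [hlim, enorm_zero] at hpos
    exact lt_irrefl _ hpos

lemma measurableSet_genJumpSet_of_measurable {Ω : Set (E N)} (hΩ : IsOpen Ω) {u : E N → E d}
    (hu : Measurable u) : MeasurableSet (genJumpSet Ω u) := by
  obtain ⟨D, hDc, hD⟩ := TopologicalSpace.exists_countable_dense
    (E d × Metric.sphere (0 : E N) 1)
  rw [genJumpSet_eq hu hD]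
  exact hΩ.measurableSet.inter ((measurableSet_nearJumpSet hu hDc).inter
    (measurableSet_lt measurable_const (.limsup fun j => measurable_symMean hu _)))

lemma measurable_norm_genJump_of_measurable {Ω : Set (E N)} (hΩ : IsOpen Ω) {u : E N → E d}
    (hu : Measurable u) : Measurable fun x => ‖genJump Ω u x‖ := by
  have e : (fun x => ‖genJump Ω u x‖) = (genJumpSet Ω u).indicator fun x =>
      (limsup (fun j : ℕ => symMean u x ((1 / 2 : ℝ) ^ j)) atTop).toReal := by
    funext x
    by_cases hx : x ∈ genJumpSet Ω u
    · obtain ⟨ν, H⟩ := genJump_spec hx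
      have hlim := ((H.tendsto_symMean hu).comp tendsto_half_pow).limsup_eq
      simp only [Function.comp_def] at hlim
      rw [Set.indicator_of_mem hx, hlim, toReal_enorm]
    · rw [Set.indicator_of_notMem hx, genJump_of_notMem hx, norm_zero]
  rw [e]
  exact (Measurable.limsup fun j => measurable_symMean hu _).ennreal_toReal.indicator
    (measurableSet_genJumpSet_of_measurable hΩ hu)

/-! ### From covers at each scale to an integral against Hausdorff measure. -/

/-- A weighted covering estimate for the integral of a function with respect to the Hausdorff
measure: if near scale `0` every point `x` of `J` is within distance `2 ρ` of a point `b` of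
`A ρ` with `f x ≤ τ * f b`, then `∫_J f dμH[s]` is at most the lower limit of
`∑ τ f(b) (4 ρ)^s`. -/
lemma setLIntegral_hausdorffMeasure_le_liminf {X : Type*} [MetricSpace X] [MeasurableSpace X]
    [BorelSpace X] {s τ : ℝ} (hs : 0 ≤ s) {f : X → ℝ} (hf : Measurable f) (hf0 : ∀ x, 0 ≤ f x)
    {J : Set X} (hJ : MeasurableSet J) {A : ℝ → Set X} (hA : ∀ ρ, (A ρ).Countable)
    (hcov : ∀ x ∈ J, ∀ᶠ ρ in 𝓝[>] (0 : ℝ), ∃ b ∈ A ρ, dist x b ≤ 2 * ρ ∧ f x ≤ τ * f b) :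
    ∫⁻ x in J, ENNReal.ofReal (f x) ∂(Measure.hausdorffMeasure s) ≤
      liminf (fun ρ => ∑' b : A ρ, ENNReal.ofReal (τ * f b) * ENNReal.ofReal (4 * ρ) ^ s)
        (𝓝[>] 0) := by
  have hAc : ∀ ρ, Countable (A ρ) := fun ρ => (hA ρ).to_subtype
  -- `g ρ l` counts the balls relevant to the level `l`; integrating in `l` restores the weights `τ
  -- * f b`.
  set g : ℝ → ℝ → ℝ≥0∞ := fun ρ l => ∑' b : A ρ,
    (Set.Iio (τ * f b)).indicator (fun _ => ENNReal.ofReal (4 * ρ) ^ s) l with hg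
  have hgm : ∀ ρ, Measurable (g ρ) := fun ρ =>
    Measurable.tsum fun b => measurable_const.indicator measurableSet_Iio
  have hgi : ∀ ρ, ∫⁻ l in Set.Ioi 0, g ρ l =
      ∑' b : A ρ, ENNReal.ofReal (τ * f b) * ENNReal.ofReal (4 * ρ) ^ s := by
    intro ρ
    rw [lintegral_tsum fun b => (measurable_const.indicator measurableSet_Iio).aemeasurable]
    refine tsum_congr fun b => ?_
    rw [lintegral_indicator measurableSet_Iio, lintegral_const, Measure.restrict_apply_univ,
      Measure.restrict_apply measurableSet_Iio, Set.inter_comm, Set.Ioi_inter_Iio,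
      Real.volume_Ioo, sub_zero, mul_comm]
  have hlevel : ∀ l : ℝ, Measure.hausdorffMeasure s ({x | l < f x} ∩ J) ≤
      liminf (fun ρ => g ρ l) (𝓝[>] 0) := by
    intro l
    -- The threshold below which covers exist depends on the point. `S m` collects the points with a
    -- common threshold, so one cover serves all of it; the increasing union needs no measurability
    -- of `S m`.
    set S : ℕ → Set X := fun m => {x | l < f x ∧ ∀ ρ ∈ Set.Ioo (0 : ℝ) (1 / (m + 1)),
      ∃ b ∈ A ρ, dist x b ≤ 2 * ρ ∧ f x ≤ τ * f b} with hS
    have hSm : Monotone S := by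
      rintro m n hmn x ⟨h1, h2⟩
      refine ⟨h1, fun ρ hρ => h2 ρ ⟨hρ.1, hρ.2.trans_le ?_⟩⟩
      exact one_div_le_one_div_of_le (by positivity) (by gcongr)
    have hsub : {x | l < f x} ∩ J ⊆ ⋃ m, S m := by
      rintro x ⟨h1, h2⟩
      obtain ⟨δ, hδ, hδ'⟩ := mem_nhdsGT_iff_exists_Ioo_subset.1 (hcov x h2)
      obtain ⟨m, hm⟩ := exists_nat_one_div_lt (Set.mem_Ioi.1 hδ)
      exact Set.mem_iUnion.2 ⟨m, h1, fun ρ hρ => hδ' ⟨hρ.1, hρ.2.trans hm⟩⟩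
    refine (measure_mono hsub).trans ?_
    rw [hSm.directed_le.measure_iUnion]
    refine iSup_le fun m => ?_
    have hev : ∀ᶠ ρ : ℝ in 𝓝[>] 0, ρ ∈ Set.Ioo (0 : ℝ) (1 / (m + 1)) :=
      Ioo_mem_nhdsGT (by positivity)
    have hdiam : ∀ (ρ : ℝ) (b : X),
        Metric.ediam (Metric.closedBall b (2 * ρ)) ≤ ENNReal.ofReal (4 * ρ) := by
      intro ρ b
      refine Metric.ediam_le fun y hy z hz => ?_
      rw [edist_dist]
      refine ENNReal.ofReal_le_ofReal ((dist_triangle_right y z b).trans ?_)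
      rw [Metric.mem_closedBall] at hy hz
      linarith
    refine (Measure.hausdorffMeasure_le_liminf_tsum (β := ℝ) (l := 𝓝[>] 0)
      (ι := fun ρ => {b : A ρ // l < τ * f b}) s (S m)
      (fun ρ => ENNReal.ofReal (4 * ρ)) ?_ (fun ρ b => Metric.closedBall (b : X) (2 * ρ))
      (.of_forall fun ρ b => hdiam ρ _) ?_).trans ?_
    · have : Continuous fun ρ : ℝ => ENNReal.ofReal (4 * ρ) :=
        ENNReal.continuous_ofReal.comp (continuous_const_mul 4)
      simpa using (this.tendsto 0).mono_left nhdsWithin_le_nhds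
    · filter_upwards [hev] with ρ hρ x hx
      obtain ⟨b, hb, hb1, hb2⟩ := hx.2 ρ hρ
      exact Set.mem_iUnion.2 ⟨⟨⟨b, hb⟩, hx.1.trans_le hb2⟩, hb1⟩
    · refine liminf_le_liminf (.of_forall fun ρ => ?_)
      calc ∑' b : {b : A ρ // l < τ * f b}, Metric.ediam (Metric.closedBall (b : X) (2 * ρ)) ^ s
          ≤ ∑' b : {b : A ρ // l < τ * f b}, ENNReal.ofReal (4 * ρ) ^ s :=
            ENNReal.tsum_le_tsum fun b => ENNReal.rpow_le_rpow (hdiam ρ _) hs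
        _ = ∑' b : A ρ, Set.indicator {b : A ρ | l < τ * f b}
              (fun _ => ENNReal.ofReal (4 * ρ) ^ s) b :=
            tsum_subtype {b : A ρ | l < τ * f b} (fun _ => ENNReal.ofReal (4 * ρ) ^ s)
        _ = g ρ l := by
            refine tsum_congr fun b => ?_
            simp only [Set.indicator_apply, Set.mem_ofPred_eq, Set.mem_Iio]
  rw [lintegral_eq_lintegral_meas_lt _ (.of_forall hf0) hf.aemeasurable]
  calc ∫⁻ l in Set.Ioi 0, (Measure.hausdorffMeasure s).restrict J {x | l < f x}
      ≤ ∫⁻ l in Set.Ioi 0, liminf (fun ρ => g ρ l) (𝓝[>] 0) := by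
        refine lintegral_mono fun l => ?_
        rw [Measure.restrict_apply' hJ]
        exact hlevel l
    _ ≤ liminf (fun ρ => ∫⁻ l in Set.Ioi 0, g ρ l) (𝓝[>] 0) := lintegral_liminf_le hgm
    _ = _ := by simp only [hgi]

/-! ### Lower bound for the energy near one jump point. -/

/-- Chebyshev's inequality: remove from each half ball the points where `u` is far from the jump
function. -/
lemma exists_separated_sets {u : E N → E d} (hu : Measurable u) {x : E N} {h : E d} {ν : E N}
    (H : IsGenJump u x h ν) {θ : ℝ} (hθ : 0 < θ) :
    ∀ᶠ ρ in 𝓝[>] (0 : ℝ), ∃ G₁ G₂ : Set (E N), MeasurableSet G₁ ∧ MeasurableSet G₂ ∧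
      G₁ ⊆ Metric.ball x ρ ∧ G₂ ⊆ Metric.ball x ρ ∧ Disjoint G₁ G₂ ∧
      ENNReal.ofReal ((1 - θ) / 2) * volume (Metric.ball x ρ) ≤ volume G₁ ∧
      ENNReal.ofReal ((1 - θ) / 2) * volume (Metric.ball x ρ) ≤ volume G₂ ∧
      ∀ z ∈ G₁, ∀ y ∈ G₂, (1 - θ) * ‖h‖ ≤ ‖u z - u y‖ := by
  obtain ⟨h0, hν, hlim⟩ := isGenJump_iff.1 H
  have hν0 : ν ≠ 0 := by rintro rfl; simp at hν
  have hh : 0 < ‖h‖ := norm_pos_iff.2 h0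
  -- Two errors below `η` cost at most `θ * ‖h‖` of the jump. Mean oscillation below `η * (θ / 2)`
  -- leaves a bad set of at most the fraction `θ / 2` of the ball.
  set η : ℝ := θ * ‖h‖ / 2 with hη
  have hη0 : 0 < η := by positivity
  have hδ : 0 < ENNReal.ofReal (η * (θ / 2)) := ENNReal.ofReal_pos.2 (by positivity)
  filter_upwards [hlim.eventually_lt_const hδ, self_mem_nhdsWithin] with ρ hρ hρ0
  have hρ0 : 0 < ρ := hρ0
  obtain ⟨c, hc⟩ := iInf_lt_iff.1 hρ
  set w : E N → E d := fun y => u y - halfModel h ν (y - x) - c with hw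
  have hwm : Measurable w :=
    (hu.sub ((measurable_halfModel h ν).comp (measurable_sub_const x))).sub_const c
  have hb0 : volume (Metric.ball x ρ) ≠ 0 := (Metric.measure_ball_pos volume x hρ0).ne'
  have hbt : volume (Metric.ball x ρ) ≠ ∞ := measure_ball_lt_top.ne
  set bad : Set (E N) := {y | ENNReal.ofReal η ≤ ‖w y‖ₑ} with hbad
  have hbadm : MeasurableSet bad := measurableSet_le measurable_const hwm.enorm
  have hbadv : volume (bad ∩ Metric.ball x ρ) ≤
      ENNReal.ofReal (θ / 2) * volume (Metric.ball x ρ) := by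
    have h1 := mul_meas_ge_le_lintegral (μ := volume.restrict (Metric.ball x ρ)) hwm.enorm
      (ENNReal.ofReal η)
    rw [Measure.restrict_apply hbadm] at h1
    rw [setLAverage_eq] at hc
    have h2 : ∫⁻ y in Metric.ball x ρ, ‖w y‖ₑ ≤
        ENNReal.ofReal (η * (θ / 2)) * volume (Metric.ball x ρ) :=
      (ENNReal.div_le_iff hb0 hbt).1 hc.le
    rw [ENNReal.ofReal_mul hη0.le, mul_assoc] at h2
    exact (ENNReal.mul_le_mul_iff_right (ENNReal.ofReal_pos.2 hη0).ne' ENNReal.ofReal_ne_top).1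
      (h1.trans h2)
  have hvol : ∀ ν' : E N, ν' ≠ 0 → ENNReal.ofReal ((1 - θ) / 2) * volume (Metric.ball x ρ) ≤
      volume (halfBall x ρ ν' \ bad) := by
    intro ν' hν'
    have h1 : volume (halfBall x ρ ν') ≤ volume (halfBall x ρ ν' \ bad) +
        ENNReal.ofReal (θ / 2) * volume (Metric.ball x ρ) := by
      rw [← measure_sdiff_add_inter _ hbadm]
      gcongr
      refine (measure_mono ?_).trans hbadv
      exact fun y hy => ⟨hy.2, hy.1.1⟩
    have h2 : volume (halfBall x ρ ν') = ENNReal.ofReal (1 / 2) * volume (Metric.ball x ρ) := by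
      rw [← two_mul_volume_halfBall hν' x ρ, ← mul_assoc]
      have : ENNReal.ofReal (1 / 2) * 2 = 1 := by
        rw [← ENNReal.ofReal_ofNat 2, ← ENNReal.ofReal_mul (by norm_num)]
        norm_num
      rw [this, one_mul]
    rw [h2] at h1
    rw [show (1 - θ) / 2 = 1 / 2 - θ / 2 by ring, ENNReal.ofReal_sub _ (by positivity),
      ENNReal.sub_mul fun _ _ => hbt]
    exact tsub_le_iff_right.2 h1
  refine ⟨halfBall x ρ ν \ bad, halfBall x ρ (-ν) \ bad,
    (measurableSet_halfBall _ _ _).diff hbadm, (measurableSet_halfBall _ _ _).diff hbadm,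
    fun y hy => hy.1.1, fun y hy => hy.1.1,
    (disjoint_halfBall_neg x ρ ν).mono Set.sdiff_subset Set.sdiff_subset,
    hvol ν hν0, hvol (-ν) (neg_ne_zero.2 hν0), ?_⟩
  have hgood : ∀ y, y ∉ bad → ‖w y‖ < η := by
    intro y hy
    rw [hbad, Set.mem_ofPred_eq, not_le, ← ofReal_norm] at hy
    exact (ENNReal.ofReal_lt_ofReal_iff hη0).1 hy
  rintro z ⟨hz, hzb⟩ y ⟨hy, hyb⟩
  have hy' : inner ℝ (y - x) ν ≤ 0 := by
    have := hy.2
    rw [inner_neg_right] at this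
    linarith
  have e : h = (u z - u y) - (w z - w y) := by
    simp only [hw, halfModel_of_pos hz.2, halfModel_of_nonpos hy']
    abel
  have h1 : ‖h‖ ≤ ‖u z - u y‖ + (‖w z‖ + ‖w y‖) := by
    calc ‖h‖ = ‖(u z - u y) - (w z - w y)‖ := by rw [← e]
      _ ≤ _ := (norm_sub_le _ _).trans (add_le_add_right (norm_sub_le _ _) _)
  have := hgood z hzb
  have := hgood y hyb
  have : η = θ * ‖h‖ / 2 := rfl
  linarith

/-- The energy density of a pair of points. -/
noncomputable def besovKernel (u : E N → E d) (q ε : ℝ) (z y : E N) : ℝ≥0∞ :=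
  ENNReal.ofReal (1 / ε ^ N * (‖u z - u y‖ ^ q / ‖z - y‖))

lemma le_besovKernel {u : E N → E d} {q ε a L : ℝ} (hq : 0 < q) (hε : 0 < ε) (ha : 0 < a)
    {z y : E N} (h : a ≤ ‖u z - u y‖) (hL : ‖z - y‖ ≤ L) :
    ENNReal.ofReal (1 / ε ^ N * (a ^ q / L)) ≤ besovKernel u q ε z y := by
  have hzy : 0 < ‖z - y‖ := by
    refine norm_pos_iff.2 fun e => ?_
    rw [sub_eq_zero.1 e, sub_self, norm_zero] at h
    linarith
  refine ENNReal.ofReal_le_ofReal ?_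
  have : a ^ q ≤ ‖u z - u y‖ ^ q := Real.rpow_le_rpow ha.le h hq.le
  gcongr

lemma volume_ball_eq_alpha (hN : 1 ≤ N) (x : E N) {ρ : ℝ} (hρ : 0 ≤ ρ) :
    volume (Metric.ball x ρ) = ENNReal.ofReal (alpha N * ρ ^ N) := by
  have : Nonempty (Fin N) := ⟨⟨0, hN⟩⟩
  rw [EuclideanSpace.volume_ball, Fintype.card_fin, ← ENNReal.ofReal_pow hρ,
    ← ENNReal.ofReal_mul (by positivity), mul_comm, alpha,
    Real.sqrt_eq_rpow, ← Real.rpow_natCast, ← Real.rpow_mul Real.pi_pos.le, one_div_mul_eq_div]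

lemma alpha_pos {s : ℝ} (hs : 0 ≤ s) : 0 < alpha s :=
  div_pos (Real.rpow_pos_of_pos Real.pi_pos _) (Real.Gamma_pos_of_pos (by linarith))

/-- The part of the energy of a jump of size one that is seen in a unit ball with `ε = 2`. -/
noncomputable def energyConst (N : ℕ) : ℝ := alpha N ^ 2 * (1 + (1 / 4) ^ N) / 2 ^ (N + 2)

lemma energyConst_pos (N : ℕ) : 0 < energyConst N := by
  have := alpha_pos (Nat.cast_nonneg (α := ℝ) N)
  unfold energyConst
  positivity

lemma two_mul_sq_le_prod {G₁ G₂ B : Set (E N)} (h1 : MeasurableSet G₁) (h2 : MeasurableSet G₂)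
    (hB1 : G₁ ⊆ B) (hB2 : G₂ ⊆ B) (hd : Disjoint G₁ G₂) {V : ℝ≥0∞} (hV1 : V ≤ volume G₁)
    (hV2 : V ≤ volume G₂) :
    2 * (V * V) ≤ ((volume.restrict B).prod (volume.restrict B)) (G₁ ×ˢ G₂ ∪ G₂ ×ˢ G₁) := by
  rw [measure_union (Set.Disjoint.set_prod_left hd _ _) (h2.prod h1), Measure.prod_prod,
    Measure.prod_prod, Measure.restrict_apply h1, Measure.restrict_apply h2,
    Set.inter_eq_left.2 hB1, Set.inter_eq_left.2 hB2, two_mul]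
  gcongr

/-- The power `q` accounts for the loss in the jump size, the square for the loss in the volumes of
the two separated sets. -/
lemma exists_pow_mul_rpow_gt {κ : ℝ} (hκ : κ < 1) (q : ℝ) :
    ∃ θ : ℝ, 0 < θ ∧ θ < 1 ∧ κ < (1 - θ) ^ q * (1 - θ) ^ 2 := by
  have hc : ContinuousAt (fun θ : ℝ => (1 - θ) ^ q * (1 - θ) ^ 2) 0 :=
    (ContinuousAt.rpow_const (by fun_prop) (Or.inl (by norm_num))).mul (by fun_prop)
  have h0 : κ < (1 - (0 : ℝ)) ^ q * (1 - 0) ^ 2 := by simpa using hκ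
  have h1 := (hc.eventually_const_lt h0).filter_mono (nhdsWithin_le_nhds (s := Set.Ioi 0))
  obtain ⟨θ, h2, h3, h4⟩ := (h1.and (Ioo_mem_nhdsGT (zero_lt_one (α := ℝ)))).exists
  exact ⟨θ, h3, h4, h2⟩

lemma tendsto_half_nhdsGT_zero : Tendsto (fun ρ : ℝ => ρ / 2) (𝓝[>] 0) (𝓝[>] 0) := by
  refine tendsto_nhdsWithin_iff.2 ⟨?_, ?_⟩
  · have : Continuous fun ρ : ℝ => ρ / 2 := by fun_prop
    simpa using (this.tendsto 0).mono_left nhdsWithin_le_nhds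
  · filter_upwards [self_mem_nhdsWithin] with ρ hρ
    exact Set.mem_Ioi.2 (half_pos (Set.mem_Ioi.1 hρ))

/-- The energy near a jump point is asymptotically at least that of a jump function. -/
lemma le_lintegral_besovKernel (hN : 1 ≤ N) {u : E N → E d} (hu : Measurable u) {x : E N}
    {h : E d} {ν : E N} (H : IsGenJump u x h ν) {q κ : ℝ} (hq : 0 < q) (hκ : κ < 1) :
    ∀ᶠ ρ in 𝓝[>] (0 : ℝ), ENNReal.ofReal (κ * ‖h‖ ^ q * (ρ ^ (N - 1) * energyConst N)) ≤
      ∫⁻ z in Metric.ball x ρ, ∫⁻ y in Metric.ball x ρ, besovKernel u q (2 * ρ) z y := by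
  obtain ⟨θ, hθ0, hθ1, hθκ⟩ := exists_pow_mul_rpow_gt hκ q
  have hh : 0 < ‖h‖ := norm_pos_iff.2 H.1
  have hsep := exists_separated_sets hu H hθ0
  filter_upwards [hsep, tendsto_half_nhdsGT_zero.eventually hsep, self_mem_nhdsWithin] with ρ hρ hρ' hρ0
  have hρ0 : 0 < ρ := hρ0
  obtain ⟨G₁, G₂, hm1, hm2, hB1, hB2, hd, hv1, hv2, hG⟩ := hρ
  obtain ⟨F₁, F₂, hm1', hm2', hB1', hB2', hd', hv1', hv2', hF⟩ := hρ'
  rw [volume_ball_eq_alpha hN x hρ0.le, ← ENNReal.ofReal_mul (by linarith)] at hv1 hv2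
  rw [volume_ball_eq_alpha hN x (half_pos hρ0).le, ← ENNReal.ofReal_mul (by linarith)] at hv1' hv2'
  have hsub : Metric.ball x (ρ / 2) ⊆ Metric.ball x ρ := Metric.ball_subset_ball (by linarith)
  set B := Metric.ball x ρ with hB
  set T : Set (E N × E N) := G₁ ×ˢ G₂ ∪ G₂ ×ˢ G₁ with hT
  set T' : Set (E N × E N) := F₁ ×ˢ F₂ ∪ F₂ ×ˢ F₁ with hT'
  have hTm : MeasurableSet T := (hm1.prod hm2).union (hm2.prod hm1)
  have hTm' : MeasurableSet T' := (hm1'.prod hm2').union (hm2'.prod hm1')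
  set a : ℝ := (1 - θ) * ‖h‖ with ha
  have ha0 : 0 < a := mul_pos (by linarith) hh
  set C : ℝ := 1 / (2 * ρ) ^ N * (a ^ q / (2 * ρ)) with hC
  have hC0 : 0 ≤ C := by positivity
  have hdist : ∀ {r : ℝ} {z y : E N}, z ∈ Metric.ball x r → y ∈ Metric.ball x r →
      ‖z - y‖ ≤ 2 * r := by
    intro r z y hz hy
    rw [← dist_eq_norm]
    rw [Metric.mem_ball] at hz hy
    linarith [dist_triangle_right z y x]
  have hTk : ∀ p ∈ T, ENNReal.ofReal C ≤ besovKernel u q (2 * ρ) p.1 p.2 := by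
    rintro ⟨z, y⟩ (⟨hz, hy⟩ | ⟨hz, hy⟩)
    · exact le_besovKernel hq (by linarith) ha0 (hG z hz y hy) (hdist (hB1 hz) (hB2 hy))
    · exact le_besovKernel hq (by linarith) ha0 (by rw [norm_sub_rev]; exact hG y hy z hz)
        (hdist (hB2 hz) (hB1 hy))
  -- Points of the half-radius ball are at most `ρ` apart instead of `2 * ρ`, so the kernel is at
  -- least `2 * C`. This leaves room for both indicators in `K`, however `T` and `T'` overlap.
  have hTk' : ∀ p ∈ T', ENNReal.ofReal C + ENNReal.ofReal C ≤
      besovKernel u q (2 * ρ) p.1 p.2 := by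
    have e : ENNReal.ofReal C + ENNReal.ofReal C =
        ENNReal.ofReal (1 / (2 * ρ) ^ N * (a ^ q / (2 * (ρ / 2)))) := by
      rw [← ENNReal.ofReal_add hC0 hC0, hC]
      congr 1
      field_simp
      ring
    rw [e]
    rintro ⟨z, y⟩ (⟨hz, hy⟩ | ⟨hz, hy⟩)
    · exact le_besovKernel hq (by linarith) ha0 (hF z hz y hy) (hdist (hB1' hz) (hB2' hy))
    · exact le_besovKernel hq (by linarith) ha0 (by rw [norm_sub_rev]; exact hF y hy z hz)
        (hdist (hB2' hz) (hB1' hy))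
  set K : E N × E N → ℝ≥0∞ := fun p =>
    T.indicator (fun _ => ENNReal.ofReal C) p + T'.indicator (fun _ => ENNReal.ofReal C) p with hK
  have hKm : Measurable K :=
    (measurable_const.indicator hTm).add (measurable_const.indicator hTm')
  have hKle : ∀ z y, K (z, y) ≤ besovKernel u q (2 * ρ) z y := by
    intro z y
    by_cases h' : (z, y) ∈ T'
    · refine le_trans (add_le_add (Set.indicator_le_self' ?_ _) (Set.indicator_le_self' ?_ _))
        (hTk' (z, y) h') <;> exact fun _ _ => zero_le
    · simp only [hK, Set.indicator_of_notMem h', add_zero]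
      by_cases h'' : (z, y) ∈ T
      · rw [Set.indicator_of_mem h'']
        exact hTk (z, y) h''
      · rw [Set.indicator_of_notMem h'']
        exact zero_le
  have hα := alpha_pos (Nat.cast_nonneg (α := ℝ) N)
  set v : ℝ := (1 - θ) / 2 * (alpha N * ρ ^ N) with hv
  set v' : ℝ := (1 - θ) / 2 * (alpha N * (ρ / 2) ^ N) with hv'
  have hθ2 : 0 < 1 - θ := by linarith
  have hv0 : 0 ≤ v := by positivity
  have hv0' : 0 ≤ v' := by positivity
  calc ENNReal.ofReal (κ * ‖h‖ ^ q * (ρ ^ (N - 1) * energyConst N))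
      ≤ ENNReal.ofReal (C * (2 * (v * v)) + C * (2 * (v' * v'))) := by
        refine ENNReal.ofReal_le_ofReal ?_
        have e : C * (2 * (v * v)) + C * (2 * (v' * v')) =
            (1 - θ) ^ q * (1 - θ) ^ 2 * ‖h‖ ^ q * (ρ ^ (N - 1) * energyConst N) := by
          obtain ⟨n, rfl⟩ : ∃ n, N = n + 1 := ⟨N - 1, by omega⟩
          rw [hC, ha, Real.mul_rpow hθ2.le hh.le, hv, hv', energyConst, div_pow ρ 2,
            show (1 / 4 : ℝ) = 1 / 2 * (1 / 2) by norm_num, mul_pow (1 / 2 : ℝ), one_div_pow,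
            mul_pow 2 ρ, Nat.add_sub_cancel]
          field_simp
          ring
        rw [e]
        have := energyConst_pos N
        gcongr
    _ = ENNReal.ofReal C * (2 * (ENNReal.ofReal v * ENNReal.ofReal v)) +
          ENNReal.ofReal C * (2 * (ENNReal.ofReal v' * ENNReal.ofReal v')) := by
        rw [ENNReal.ofReal_add (by positivity) (by positivity), ENNReal.ofReal_mul hC0,
          ENNReal.ofReal_mul hC0, ENNReal.ofReal_mul zero_le_two, ENNReal.ofReal_mul zero_le_two,
          ENNReal.ofReal_mul hv0, ENNReal.ofReal_mul hv0', ENNReal.ofReal_ofNat]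
    _ ≤ ENNReal.ofReal C * ((volume.restrict B).prod (volume.restrict B)) T +
          ENNReal.ofReal C * ((volume.restrict B).prod (volume.restrict B)) T' := by
        gcongr
        · exact two_mul_sq_le_prod hm1 hm2 hB1 hB2 hd hv1 hv2
        · exact two_mul_sq_le_prod hm1' hm2' (hB1'.trans hsub) (hB2'.trans hsub) hd' hv1' hv2'
    _ = ∫⁻ p, K p ∂((volume.restrict B).prod (volume.restrict B)) := by
        rw [hK, lintegral_add_left (measurable_const.indicator hTm),
          lintegral_indicator_const hTm, lintegral_indicator_const hTm']
    _ = ∫⁻ z in B, ∫⁻ y in B, K (z, y) := lintegral_prod _ hKm.aemeasurable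
    _ ≤ _ := lintegral_mono fun z => lintegral_mono fun y => hKle z y

/-! ### Packing by disjoint balls and summation of the energies. -/

/-- The energies in disjoint balls of radius `ρ` add up to at most the energy with `ε = 2 ρ`. -/
lemma tsum_le_besovEnergy (Ω : Set (E N)) (q : ℝ) (u : E N → E d) {ρ : ℝ} {A : Set (E N)}
    (hA : A.Countable) (hsub : ∀ b ∈ A, Metric.ball b ρ ⊆ Ω)
    (hd : A.PairwiseDisjoint fun b => Metric.ball b ρ) :
    ∑' b : A, ∫⁻ z in Metric.ball (b : E N) ρ, ∫⁻ y in Metric.ball (b : E N) ρ,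
      besovKernel u q (2 * ρ) z y ≤ besovEnergy Ω q u (2 * ρ) := by
  calc ∑' b : A, ∫⁻ z in Metric.ball (b : E N) ρ, ∫⁻ y in Metric.ball (b : E N) ρ,
        besovKernel u q (2 * ρ) z y
      ≤ ∑' b : A, ∫⁻ z in Metric.ball (b : E N) ρ, ∫⁻ y in Ω ∩ Metric.ball z (2 * ρ),
        besovKernel u q (2 * ρ) z y := by
        refine ENNReal.tsum_le_tsum fun b => setLIntegral_mono' measurableSet_ball fun z hz =>
          lintegral_mono_set fun y hy => ⟨hsub b b.2 hy, ?_⟩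
        rw [Metric.mem_ball] at *
        linarith [dist_triangle_right y z (b : E N)]
    _ = ∫⁻ z in ⋃ b ∈ A, Metric.ball b ρ, ∫⁻ y in Ω ∩ Metric.ball z (2 * ρ),
        besovKernel u q (2 * ρ) z y :=
        (lintegral_biUnion hA (fun _ _ => measurableSet_ball) hd _).symm
    _ ≤ besovEnergy Ω q u (2 * ρ) := lintegral_mono_set (Set.iUnion₂_subset hsub)

/-- Balls of radius `ρ` around points of `t`, chosen greedily with respect to `f`. -/
lemma exists_greedy_disjoint_balls {f : E N → ℝ} (hf : ∀ x, 0 ≤ f x) {ρ τ R : ℝ} (hρ : 0 < ρ)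
    (hτ : 1 < τ) {t : Set (E N)} (hR : ∀ x ∈ t, f x ≤ R) :
    ∃ A ⊆ t, A.Countable ∧ (A.PairwiseDisjoint fun b => Metric.ball b ρ) ∧
      ∀ x ∈ t, ∃ b ∈ A, dist x b ≤ 2 * ρ ∧ f x ≤ τ * f b := by
  obtain ⟨A, hAt, hd, hc⟩ := Vitali.exists_disjoint_subfamily_covering_enlargement
    (fun x : E N => Metric.ball x ρ) t f τ hτ (fun x _ => hf x) R hR
    (fun x _ => Metric.nonempty_ball.2 hρ)
  refine ⟨A, hAt, hd.countable_of_isOpen (fun _ _ => Metric.isOpen_ball)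
    (fun _ _ => Metric.nonempty_ball.2 hρ), hd, fun x hx => ?_⟩
  obtain ⟨b, hb, ⟨y, hy1, hy2⟩, hb'⟩ := hc x hx
  refine ⟨b, hb, ?_, hb'⟩
  rw [Metric.mem_ball] at hy1 hy2
  linarith [dist_triangle_left x b y]

/-- Doubling maps the small positive radii onto the small positive values of `ε`, so nothing is lost
by taking `ε = 2 * ρ`. -/
lemma liminf_besovEnergy_two_mul_le (Ω : Set (E N)) (q : ℝ) (u : E N → E d) :
    liminf (fun ρ => besovEnergy Ω q u (2 * ρ)) (𝓝[>] 0) ≤ lowerBesovConst Ω q u := by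
  have hdouble : 𝓝[>] (0 : ℝ) ≤ map (fun ρ => 2 * ρ) (𝓝[>] 0) :=
    le_map_of_right_inverse (mba := fun ρ => ρ / 2)
      (Eventually.of_forall fun ρ => mul_div_cancel₀ ρ two_ne_zero) tendsto_half_nhdsGT_zero
  change liminf (besovEnergy Ω q u ∘ fun ρ => 2 * ρ) (𝓝[>] 0) ≤ _
  rw [liminf_comp]
  exact liminf_le_liminf_of_le hdouble

lemma natCast_sub_one_eq (hN : 1 ≤ N) : ((N : ℝ) - 1) = ((N - 1 : ℕ) : ℝ) := by
  push_cast [Nat.cast_sub hN]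
  ring

lemma ofReal_mul_rpow_eq (hN : 1 ≤ N) {κ τ a ρ : ℝ} (hκ : 0 < κ) (hτ : 0 ≤ τ) (ha : 0 ≤ a)
    (hρ : 0 ≤ ρ) :
    ENNReal.ofReal (τ * a) * ENNReal.ofReal (4 * ρ) ^ ((N : ℝ) - 1) =
      ENNReal.ofReal (τ * 4 ^ (N - 1) / (κ * energyConst N)) *
        ENNReal.ofReal (κ * a * (ρ ^ (N - 1) * energyConst N)) := by
  have hK := energyConst_pos N
  rw [natCast_sub_one_eq hN, ENNReal.rpow_natCast, ← ENNReal.ofReal_pow (by positivity),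
    ← ENNReal.ofReal_mul (by positivity), ← ENNReal.ofReal_mul (by positivity)]
  congr 1
  rw [mul_pow]
  field_simp

lemma setLIntegral_genJump_le {Ω : Set (E N)} (hN : 1 ≤ N) (hΩ : IsOpen Ω) {u : E N → E d}
    (hu : Measurable u) {q κ τ : ℝ} (hq : 0 < q) (hκ0 : 0 < κ) (hκ : κ < 1) (hτ : 1 < τ) :
    ∫⁻ x in genJumpSet Ω u, ENNReal.ofReal (‖genJump Ω u x‖ ^ q)
        ∂(Measure.hausdorffMeasure ((N : ℝ) - 1)) ≤
      ENNReal.ofReal (τ * 4 ^ (N - 1) / (κ * energyConst N)) * lowerBesovConst Ω q u := by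
  set f : E N → ℝ := fun x => ‖genJump Ω u x‖ ^ q with hf
  have hf0 : ∀ x, 0 ≤ f x := fun x => by positivity
  have hfm : Measurable f := (measurable_norm_genJump_of_measurable hΩ hu).pow_const q
  have hK := energyConst_pos N
  set M : ℝ := τ * 4 ^ (N - 1) / (κ * energyConst N) with hM
  -- The bound `f x ≤ 1 / ρ` supplies the upper bound that the greedy selection requires; like the
  -- other two conditions, it holds at each jump point for all small `ρ`.
  set t : ℝ → Set (E N) := fun ρ => {x | Metric.ball x ρ ⊆ Ω ∧ f x ≤ 1 / ρ ∧
    ENNReal.ofReal (κ * f x * (ρ ^ (N - 1) * energyConst N)) ≤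
      ∫⁻ z in Metric.ball x ρ, ∫⁻ y in Metric.ball x ρ, besovKernel u q (2 * ρ) z y} with ht
  have hex : ∀ ρ, ∃ A : Set (E N), A.Countable ∧ (0 < ρ → A ⊆ t ρ ∧
      (A.PairwiseDisjoint fun b => Metric.ball b ρ) ∧
      ∀ x ∈ t ρ, ∃ b ∈ A, dist x b ≤ 2 * ρ ∧ f x ≤ τ * f b) := by
    intro ρ
    by_cases hρ : 0 < ρ
    · obtain ⟨A, h1, h2, h3, h4⟩ := exists_greedy_disjoint_balls hf0 hρ hτ
        (t := t ρ) (R := 1 / ρ) fun x hx => hx.2.1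
      exact ⟨A, h2, fun _ => ⟨h1, h3, h4⟩⟩
    · exact ⟨∅, Set.countable_empty, fun h => absurd h hρ⟩
  choose A hAc hA using hex
  have hcov : ∀ x ∈ genJumpSet Ω u,
      ∀ᶠ ρ in 𝓝[>] (0 : ℝ), ∃ b ∈ A ρ, dist x b ≤ 2 * ρ ∧ f x ≤ τ * f b := by
    intro x hx
    obtain ⟨ν, H⟩ := genJump_spec hx
    obtain ⟨r, hr, hrΩ⟩ := Metric.isOpen_iff.1 hΩ x hx.1
    have hinv : ∀ᶠ ρ : ℝ in 𝓝[>] 0, f x ≤ 1 / ρ := by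
      simpa only [one_div] using tendsto_inv_nhdsGT_zero.eventually_ge_atTop (f x)
    filter_upwards [le_lintegral_besovKernel hN hu H hq hκ, hinv, Ioo_mem_nhdsGT hr]
      with ρ h1 h2 h3
    exact (hA ρ h3.1).2.2 x ⟨(Metric.ball_subset_ball h3.2.le).trans hrΩ, h2, h1⟩
  calc ∫⁻ x in genJumpSet Ω u, ENNReal.ofReal (f x) ∂(Measure.hausdorffMeasure ((N : ℝ) - 1))
      ≤ liminf (fun ρ => ∑' b : A ρ, ENNReal.ofReal (τ * f b) *
          ENNReal.ofReal (4 * ρ) ^ ((N : ℝ) - 1)) (𝓝[>] 0) :=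
        setLIntegral_hausdorffMeasure_le_liminf (by rw [natCast_sub_one_eq hN]; positivity) hfm hf0
          (measurableSet_genJumpSet_of_measurable hΩ hu) hAc hcov
    _ ≤ liminf (fun ρ => ENNReal.ofReal M * besovEnergy Ω q u (2 * ρ)) (𝓝[>] 0) := by
        refine liminf_le_liminf ?_
        filter_upwards [self_mem_nhdsWithin] with ρ hρ
        have hρ0 : 0 < ρ := hρ
        obtain ⟨h1, h2, -⟩ := hA ρ hρ0
        refine le_trans ?_ (mul_le_mul_right
          (tsum_le_besovEnergy Ω q u (hAc ρ) (fun b hb => (h1 hb).1) h2) _)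
        rw [← ENNReal.tsum_mul_left]
        refine ENNReal.tsum_le_tsum fun b => ?_
        refine le_trans (le_of_eq ?_) (mul_le_mul_right (h1 b.2).2.2 _)
        exact ofReal_mul_rpow_eq hN hκ0 (by linarith) (hf0 _) hρ0.le
    _ = ENNReal.ofReal M * liminf (fun ρ => besovEnergy Ω q u (2 * ρ)) (𝓝[>] 0) :=
        ENNReal.liminf_const_mul_of_ne_top ENNReal.ofReal_ne_top
    _ ≤ ENNReal.ofReal M * lowerBesovConst Ω q u := by
        exact mul_le_mul_right (liminf_besovEnergy_two_mul_le Ω q u) _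

/-! ### The improved constant and the inequality for measurable functions. -/

/-- A constant for the lower bound which is better than `gammaConst`. -/
noncomputable def improvedConst (N : ℕ) : ℝ :=
  alpha N ^ 2 * (1 + (1 / 4) ^ N / 2) / (2 ^ (2 * N + 1) * alpha ((N : ℝ) - 1))

lemma alpha_natCast_sub_one_pos (hN : 1 ≤ N) : 0 < alpha ((N : ℝ) - 1) :=
  alpha_pos (sub_nonneg.2 (by exact_mod_cast hN))

lemma gammaConst_pos (hN : 1 ≤ N) : 0 < gammaConst N := by
  have := alpha_pos (Nat.cast_nonneg (α := ℝ) N)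
  have := alpha_natCast_sub_one_pos hN
  unfold gammaConst
  positivity

lemma gammaConst_lt_improvedConst (hN : 1 ≤ N) : gammaConst N < improvedConst N := by
  have h1 := alpha_pos (Nat.cast_nonneg (α := ℝ) N)
  have h2 := alpha_natCast_sub_one_pos hN
  have h3 : (1 : ℝ) ≤ 5 ^ (N - 1) := one_le_pow₀ (by norm_num)
  calc gammaConst N ≤ alpha N ^ 2 / (1 * 2 ^ (2 * N + 1) * alpha ((N : ℝ) - 1)) := by
        unfold gammaConst
        gcongr
    _ = alpha N ^ 2 * 1 / (2 ^ (2 * N + 1) * alpha ((N : ℝ) - 1)) := by rw [one_mul, mul_one]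
    _ < improvedConst N := by
        unfold improvedConst
        gcongr
        have : (0 : ℝ) < (1 / 4) ^ N / 2 := by positivity
        linarith

lemma improvedConst_mul_jumpVariation_le_of_measurable (hN : 1 ≤ N) {Ω : Set (E N)}
    (hΩ : IsOpen Ω) {u : E N → E d} (hu : Measurable u) {q : ℝ} (hq : 0 < q) :
    ENNReal.ofReal (improvedConst N) * jumpVariation Ω q u ≤ lowerBesovConst Ω q u := by
  have hα := alpha_pos (Nat.cast_nonneg (α := ℝ) N)
  have hα1 := alpha_natCast_sub_one_pos hN
  set σ : ℝ := (1 / 4) ^ N with hσ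
  have hσ0 : 0 < σ := by positivity
  -- The method yields `1 + σ` up to the factor `κ / τ`, while `improvedConst` claims only `1 + σ /
  -- 2`; `κ` and `τ` are taken close enough to `1` to fit in this gap.
  obtain ⟨κ, hκ0, hκ1⟩ : ∃ κ : ℝ, (1 + σ / 2) / (1 + σ) < κ ∧ κ < 1 :=
    exists_between ((div_lt_one (by positivity)).2 (by linarith))
  obtain ⟨τ, hτ1, hτ2⟩ : ∃ τ : ℝ, 1 < τ ∧ τ < κ * (1 + σ) / (1 + σ / 2) :=
    exists_between (by
      rw [div_lt_iff₀ (by positivity)] at hκ0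
      rw [lt_div_iff₀ (by positivity)]
      linarith)
  have hκpos : 0 < κ := lt_trans (by positivity) hκ0
  have hK := energyConst_pos N
  have hs : (2 : ℝ) ^ ((N : ℝ) - 1) = 2 ^ (N - 1) := by
    rw [← Real.rpow_natCast]
    congr 1
    push_cast [Nat.cast_sub hN]
    ring
  have hI : 0 ≤ improvedConst N := (gammaConst_pos hN).le.trans (gammaConst_lt_improvedConst hN).le
  rw [jumpVariation, hausdorff, Measure.restrict_smul, lintegral_smul_measure, smul_eq_mul, hs]
  refine le_trans (mul_le_mul_right (mul_le_mul_right
    (setLIntegral_genJump_le hN hΩ hu hq hκpos hκ1 hτ1) _) _) ?_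
  rw [← mul_assoc, ← mul_assoc, ← ENNReal.ofReal_mul hI,
    ← ENNReal.ofReal_mul (by positivity)]
  refine mul_le_of_le_one_left zero_le ?_
  rw [ENNReal.ofReal_le_one]
  have e : improvedConst N * (alpha ((N : ℝ) - 1) / 2 ^ (N - 1)) *
      (τ * 4 ^ (N - 1) / (κ * energyConst N)) = τ * (1 + σ / 2) / (κ * (1 + σ)) := by
    obtain ⟨n, rfl⟩ : ∃ n, N = n + 1 := ⟨N - 1, by omega⟩
    rw [improvedConst, energyConst, ← hσ, Nat.add_sub_cancel, show (4 : ℝ) = 2 * 2 by norm_num,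
      mul_pow (2 : ℝ) 2]
    field_simp
    ring
  rw [e, div_le_one (by positivity)]
  exact ((lt_div_iff₀ (by positivity)).1 hτ2).le

/-! ### Passing to almost everywhere measurable functions -/

lemma besovEnergy_congr {Ω : Set (E N)} {u v : E N → E d}
    (h : u =ᵐ[volume.restrict Ω] v) (q ε : ℝ) : besovEnergy Ω q u ε = besovEnergy Ω q v ε := by
  unfold besovEnergy
  refine lintegral_congr_ae ?_
  filter_upwards [h] with x hx
  refine lintegral_congr_ae ?_
  filter_upwards [ae_restrict_of_ae_restrict_of_subset Set.inter_subset_left h] with y hy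
  rw [hx, hy]

/-- Only small balls inside `Ω` matter. The equality of predicates, rather than an equivalence for
each pair, ensures that the choice made in `genJump` is the same for `u` and `v`. -/
lemma isGenJump_congr {Ω : Set (E N)} (hΩ : IsOpen Ω) {u v : E N → E d}
    (h : u =ᵐ[volume.restrict Ω] v) {x : E N} (hx : x ∈ Ω) : IsGenJump u x = IsGenJump v x := by
  funext a ν
  obtain ⟨r, hr, hrΩ⟩ := Metric.isOpen_iff.1 hΩ x hx
  simp only [isGenJump_iff, eq_iff_iff]
  refine and_congr_right fun _ => and_congr_right fun _ => tendsto_congr' ?_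
  filter_upwards [Ioo_mem_nhdsGT hr] with ρ hρ
  have h' := ae_restrict_of_ae_restrict_of_subset
    ((Metric.ball_subset_ball hρ.2.le).trans hrΩ) h
  refine iInf_congr fun c => laverage_congr ?_
  filter_upwards [h'] with y hy
  rw [hy]

lemma genJumpSet_congr {Ω : Set (E N)} (hΩ : IsOpen Ω) {u v : E N → E d}
    (h : u =ᵐ[volume.restrict Ω] v) : genJumpSet Ω u = genJumpSet Ω v := by
  ext x
  refine and_congr_right fun hx => ?_
  rw [isGenJump_congr hΩ h hx]

lemma genJump_congr {Ω : Set (E N)} (hΩ : IsOpen Ω) {u v : E N → E d}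
    (h : u =ᵐ[volume.restrict Ω] v) : genJump Ω u = genJump Ω v := by
  funext x
  by_cases hx : x ∈ genJumpSet Ω u
  · have hx' : x ∈ genJumpSet Ω v := genJumpSet_congr hΩ h ▸ hx
    rw [genJump, genJump, dif_pos hx, dif_pos hx']
    simp only [isGenJump_congr hΩ h hx.1]
  · rw [genJump_of_notMem hx, genJump_of_notMem (genJumpSet_congr hΩ h ▸ hx)]

section AEMeasurable

variable {Ω : Set (E N)} {u : E N → E d}

lemma measurableSet_genJumpSet (hΩ : IsOpen Ω) (hu : AEMeasurable u (volume.restrict Ω)) :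
    MeasurableSet (genJumpSet Ω u) := by
  rw [genJumpSet_congr hΩ hu.ae_eq_mk]
  exact measurableSet_genJumpSet_of_measurable hΩ hu.measurable_mk

lemma measurable_norm_genJump (hΩ : IsOpen Ω) (hu : AEMeasurable u (volume.restrict Ω)) :
    Measurable fun x => ‖genJump Ω u x‖ := by
  rw [genJump_congr hΩ hu.ae_eq_mk]
  exact measurable_norm_genJump_of_measurable hΩ hu.measurable_mk

lemma improvedConst_mul_jumpVariation_le (hN : 1 ≤ N) (hΩ : IsOpen Ω)
    (hu : AEMeasurable u (volume.restrict Ω)) {q : ℝ} (hq : 0 < q) :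
    ENNReal.ofReal (improvedConst N) * jumpVariation Ω q u ≤ lowerBesovConst Ω q u := by
  have h := improvedConst_mul_jumpVariation_le_of_measurable hN hΩ hu.measurable_mk hq
  have e : jumpVariation Ω q u = jumpVariation Ω q (hu.mk u) := by
    unfold jumpVariation
    rw [genJump_congr hΩ hu.ae_eq_mk, genJumpSet_congr hΩ hu.ae_eq_mk]
  have e' : lowerBesovConst Ω q u = lowerBesovConst Ω q (hu.mk u) := by
    unfold lowerBesovConst
    simp only [besovEnergy_congr hu.ae_eq_mk]
  rwa [e, e']

lemma lowerBesovConst_le_besovConst (q : ℝ) : lowerBesovConst Ω q u ≤ besovConst Ω q u := by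
  refine liminf_le_of_frequently_le' (Eventually.frequently ?_)
  filter_upwards [Ioo_mem_nhdsGT (zero_lt_one (α := ℝ))] with ε hε
  exact le_iSup₂ (f := fun ε (_ : ε ∈ Set.Ioo (0 : ℝ) 1) => besovEnergy Ω q u ε) ε hε

lemma memLp_norm_genJump (hN : 1 ≤ N) (hΩ : IsOpen Ω) {q : ℝ} (hq : 1 ≤ q)
    (hu : MemBVq Ω q u) :
    MemLp (fun x => ‖genJump Ω u x‖) (ENNReal.ofReal q)
      ((hausdorff N ((N : ℝ) - 1)).restrict (genJumpSet Ω u)) := by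
  have hum : AEMeasurable u (volume.restrict Ω) := hu.1.1.aemeasurable
  have hq0 : 0 < q := by linarith
  refine ⟨(measurable_norm_genJump hΩ hum).aestronglyMeasurable, ?_⟩
  have hI : 0 < improvedConst N := (gammaConst_pos hN).trans (gammaConst_lt_improvedConst hN)
  have hfin : jumpVariation Ω q u < ∞ := by
    have h := ((improvedConst_mul_jumpVariation_le hN hΩ hum hq0).trans
      (lowerBesovConst_le_besovConst q)).trans_lt hu.2
    exact ENNReal.lt_top_of_mul_ne_top_right h.ne (ENNReal.ofReal_pos.2 hI).ne'
  rw [eLpNorm_lt_top_iff_lintegral_rpow_enorm_lt_top (ENNReal.ofReal_pos.2 hq0).ne'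
    ENNReal.ofReal_ne_top, ENNReal.toReal_ofReal hq0.le]
  refine lt_of_eq_of_lt (lintegral_congr fun x => ?_) hfin
  rw [enorm_norm, ← ofReal_norm, ENNReal.ofReal_rpow_of_nonneg (norm_nonneg _) hq0.le]

end AEMeasurable

end BesovJump

theorem mainTheorem3 (N : ℕ) (hN : 1 ≤ N) :
    (∀ (d : ℕ) (Ω : Set (BesovJump.E N)) (u : BesovJump.E N → BesovJump.E d),
      IsOpen Ω → LocallyIntegrableOn u Ω volume →
        MeasurableSet (BesovJump.genJumpSet Ω u) ∧
        Measurable (fun x => ‖BesovJump.genJump Ω u x‖) ∧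
        ∀ q : ℝ, 0 < q →
          ENNReal.ofReal (BesovJump.gammaConst N) * BesovJump.jumpVariation Ω q u
            ≤ BesovJump.lowerBesovConst Ω q u) ∧
    (∃ c : ℝ, BesovJump.gammaConst N < c ∧
      ∀ (d : ℕ) (Ω : Set (BesovJump.E N)) (u : BesovJump.E N → BesovJump.E d),
        IsOpen Ω → LocallyIntegrableOn u Ω volume → ∀ q : ℝ, 0 < q →
          ENNReal.ofReal c * BesovJump.jumpVariation Ω q u
            ≤ BesovJump.lowerBesovConst Ω q u) ∧
    (∀ (d : ℕ) (Ω : Set (BesovJump.E N)) (u : BesovJump.E N → BesovJump.E d),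
      IsOpen Ω → ∀ q : ℝ, 1 ≤ q → BesovJump.MemBVq Ω q u →
        MemLp (fun x => ‖BesovJump.genJump Ω u x‖) (ENNReal.ofReal q)
          ((BesovJump.hausdorff N ((N : ℝ) - 1)).restrict (BesovJump.genJumpSet Ω u))) := by
  have hlt := BesovJump.gammaConst_lt_improvedConst hN
  refine ⟨fun d Ω u hΩ hu => ?_, ⟨BesovJump.improvedConst N, hlt, fun d Ω u hΩ hu q hq => ?_⟩,
    fun d Ω u hΩ q hq hu => BesovJump.memLp_norm_genJump hN hΩ hq hu⟩
  · have hum := hu.aestronglyMeasurable.aemeasurable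
    refine ⟨BesovJump.measurableSet_genJumpSet hΩ hum, BesovJump.measurable_norm_genJump hΩ hum,
      fun q hq => le_trans ?_ (BesovJump.improvedConst_mul_jumpVariation_le hN hΩ hum hq)⟩
    gcongr
  · exact BesovJump.improvedConst_mul_jumpVariation_le hN hΩ
      hu.aestronglyMeasurable.aemeasurable hq
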